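/- Let $d\ge 1$, $E=\mathrm{diag}(1/\alpha_1,\dots,1/\alpha_d)$ with $\alpha_k\in(0,1)$ (and $\alpha_1<1/2$ if $d=1$), and $E'=\mathrm{diag}(1/\alpha_1',\dots,1/\alpha_d')$ with $\alpha_k'>0$. Let $\mu$ be a probability measure on $\{1,2,\dots\}^d$ whose support generates the group $\mathbb Z^d$, and let $\nu$ be a full probability measure on $[0,\infty)^d$ (not carried by an affine hyperplane) such that $n^{-E}\sum_{i=1}^n\xi_i\Rightarrow\nu$ for $\xi_i$ i.i.d. with law $\mu$. Let $\psi$ be the characteristic function of $\nu$, and $\log\psi$ its continuous logarithm with $\log\psi(0)=0$. Put $\rho_k=\alpha_k/\alpha_k'$, $$\gamma_0=\min\Big\{\gamma\in\{\rho_1,\dots,\rho_d\} : \sum_{k:\rho_k\le\gamma}\tfrac1{\alpha_k}>2,\ \sum_{k:\rho_k<\gamma}\tfrac1{\alpha_k}\le 2\Big\},$$ and $I_<=\{k:\gamma_0<\rho_k\}$, $I_= =\{k:\gamma_0=\rho_k\}$, $I_>=\{k:\gamma_0>\rho_k\}$, $I_\ge=I_=\cup I_>$. Let $q(\pi_>E)=\sum_{k\in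 I_>}1/\alpha_k$ and assume $q(\pi_>E)<2$. Let $p\in(0,1)$ and $\sigma_X^2=\mathrm{Var}(X_0)/\sum_{k\in\mathbb N^d}q_k^2$, where $X_0=\pm1$ with probabilities $p$ and $1-p$, and where $q_k$ is the probability that $0$ is reached from $k$ along directed edges in the random graph on $\mathbb Z^d$ with one edge from each site $n$ to $n-Z_n$, the $Z_n$ being i.i.d. with law $\mu$. Let $(W(t))_{t\in\mathbb R^d}$ be a zero-mean real Gaussian random field with $$\mathrm{Cov}(W(t),W(s))=\sigma_X^2\prod_{k\in I_<}\frac{|t_k|+|s_k|-|t_k-s_k|}{2}\ \prod_{k\in I_>}\frac{t_ks_k}{2\pi}\ \int_{\mathbb H_\ge}|\log\psi(y)|^{-2}\prod_{k\in I_=}\frac{(e^{it_ky_k}-1)\overline{(e^{is_ky_k}-1)}}{2\pi|y_k|^2}\,d\lambda_\ge(y),$$ where $\lambda_\ge$ is Lebesgue measure on $\mathbb H_\ge=\{y\in\mathbb R^d: y_k=0\text{ for }k\notin I_\ge\}$. Then $W$ has a modification $W^*$ on $[0,1]^d$ with the following property. Let $H_j$, $j\in I_=$, be any numbers such that (a)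 $H_j=\alpha_j\big(1-q(\pi_>E)/2\big)+1/2$ if either $|I_>|=1$, or $I_>=\emptyset$ and $\alpha_j<1/2$; (b) $H_j\in(0,1)$ (arbitrary) if $I_>=\emptyset$ and $\alpha_j=1/2$; (c) $H_j=1$ if $I_>=\emptyset$ and $\alpha_j>1/2$; and set $$\rho(s,t)=\sum_{j\in I_>}|t_j-s_j|+\sum_{j\in I_<}|t_j-s_j|^{1/2}+\sum_{j\in I_=}|t_j-s_j|^{H_j}.$$ Then for every $\varepsilon>0$ there is a finite random variable $Z$ such that almost surely, for all $s,t\in[0,1]^d$, $$|W^*(t)-W^*(s)|\le Z\,\rho(s,t)\,\big(\log(1+\rho(s,t)^{-1})\big)^{1/2+\varepsilon},$$ where the right-hand side is read as $0$ when $s=t$. -/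

import Mathlib

open MeasureTheory ProbabilityTheory Filter Topology

noncomputable section

namespace OperatorScaling

/-! ### The random graph on `ℤ^d` -/

/-- The sites `ℤ^d`. -/
abbrev Site (d : ℕ) : Type := Fin d → ℤ

/-- The probability measure `μ` is carried by `{1, 2, …}^d` and aperiodic: the additive group
generated by its support is all of `ℤ^d`. -/
structure IsEdgeLaw {d : ℕ} (μ : Measure (Site d)) : Prop where
  pos : ∀ᵐ z ∂μ, ∀ k, 1 ≤ z k
  aperiodic : AddSubgroup.closure {z : Site d | μ {z} ≠ 0} = ⊤

/-- The law of the i.i.d. edges `(Z_n)_{n ∈ ℤ^d}` with distribution `μ`. -/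
def graphLaw {d : ℕ} (μ : Measure (Site d)) : Measure (Site d → Site d) :=
  Measure.infinitePi fun _ => μ

/-- The ancestral line of the site `n` in the directed graph with one edge from each site `a`
to `a - z a`: all sites that are reached from `n` along directed edges (`n` included). -/
def ancestralLine {d : ℕ} (z : Site d → Site d) (n : Site d) : Set (Site d) :=
  Set.range fun m : ℕ => (fun a => a - z a)^[m] n

/-- `q_n`, the probability that the origin lies in the ancestral line of `n`. -/
def ancestorProb {d : ℕ} (μ : Measure (Site d)) (n : Site d) : ℝ :=
  (graphLaw μ).real {z | (0 : Site d) ∈ ancestralLine z n}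

/-- The marginal law of the spins `X_j`: the value `1` with probability `p` and the value `-1`
with probability `1 - p`. -/
def spinLaw (p : ℝ) : Measure ℝ :=
  ENNReal.ofReal p • Measure.dirac 1 + ENNReal.ofReal (1 - p) • Measure.dirac (-1)

/-- `σ_X² = Var(X_0) / ∑_{k ∈ ℕ^d} q_k²`. -/
def sigmaSq {d : ℕ} (μ : Measure (Site d)) (p : ℝ) : ℝ :=
  Var[id; spinLaw p] / ∑' k : Fin d → ℕ, ancestorProb μ (fun i => (k i : ℤ)) ^ 2

/-! ### The operator stable law -/

/-- `μ` is in the strict domain of normal attraction of `(E, ν)`, `E = diag(1/α_1, …, 1/α_d)`: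
if `ξ_1, ξ_2, …` are i.i.d. with law `μ`, then `n^{-E} (ξ_1 + ⋯ + ξ_n)` converges in distribution
to `ν`. -/
def InDomainOfAttraction {d : ℕ} (μ : Measure (Site d)) [IsProbabilityMeasure μ] (α : Fin d → ℝ)
    (ν : Measure (EuclideanSpace ℝ (Fin d))) [IsProbabilityMeasure ν] : Prop :=
  TendstoInDistribution
    (fun (n : ℕ) (ξ : ℕ → Site d) => (WithLp.toLp 2 fun k =>
      (n : ℝ) ^ (-(1 / α k)) * ∑ i ∈ Finset.range n, (ξ i k : ℝ) : EuclideanSpace ℝ (Fin d)))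
    atTop id (fun _ => Measure.infinitePi fun _ : ℕ => μ) ν

/-- `ν` is full: it is not carried by an affine hyperplane. -/
def IsFull {d : ℕ} (ν : Measure (EuclideanSpace ℝ (Fin d))) : Prop :=
  ∀ (θ : EuclideanSpace ℝ (Fin d)) (c : ℝ), θ ≠ 0 → ¬ ∀ᵐ x ∂ν, inner ℝ θ x = c

/-- `L` is the logarithm of the characteristic function of `ν`: the continuous function with
`L 0 = 0` and `exp L = ψ`. -/
def IsLogCharFun {d : ℕ} (ν : Measure (EuclideanSpace ℝ (Fin d)))
    (L : EuclideanSpace ℝ (Fin d) → ℂ) : Prop :=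
  Continuous L ∧ L 0 = 0 ∧ ∀ y, Complex.exp (L y) = charFun ν y

/-- There is at most one such logarithm. -/
theorem IsLogCharFun.unique {d : ℕ} {ν : Measure (EuclideanSpace ℝ (Fin d))}
    {L₁ L₂ : EuclideanSpace ℝ (Fin d) → ℂ} (h₁ : IsLogCharFun ν L₁) (h₂ : IsLogCharFun ν L₂) :
    L₁ = L₂ := by
  refine Complex.isCoveringMap_exp.eq_of_comp_eq h₁.1 h₂.1 ?_ 0 (h₁.2.1.trans h₂.2.1.symm)
  funext y
  exact Subtype.ext ((h₁.2.2 y).trans (h₂.2.2 y).symm)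

open Classical in
/-- `log ψ` for the characteristic function `ψ` of `ν` (which has such a logarithm when `ν` is
infinitely divisible). -/
def logCharFun {d : ℕ} (ν : Measure (EuclideanSpace ℝ (Fin d))) : EuclideanSpace ℝ (Fin d) → ℂ :=
  if h : ∃ L, IsLogCharFun ν L then h.choose else 0

/-! ### The scaling regime of `E = diag(1/α_k)` and `E' = diag(1/α'_k)` -/

/-- `ρ_k = α_k / α'_k`. -/
def ratio {d : ℕ} (α α' : Fin d → ℝ) (k : Fin d) : ℝ := α k / α' k

/-- `γ₀`, the minimum of a finite set, which is nonempty when `∑ 1/α_k > 2`. -/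
def gammaZero {d : ℕ} (α α' : Fin d → ℝ) : ℝ :=
  sInf {γ : ℝ | γ ∈ Set.range (ratio α α') ∧
    2 < ∑ k with ratio α α' k ≤ γ, 1 / α k ∧ ∑ k with ratio α α' k < γ, 1 / α k ≤ 2}

/-- `I_<`. -/
def Ilt {d : ℕ} (α α' : Fin d → ℝ) : Finset (Fin d) := {k | gammaZero α α' < ratio α α' k}

/-- `I_=`. -/
def Ieq {d : ℕ} (α α' : Fin d → ℝ) : Finset (Fin d) := {k | gammaZero α α' = ratio α α' k}

/-- `I_>`. -/
def Igt {d : ℕ} (α α' : Fin d → ℝ) : Finset (Fin d) := {k | gammaZero α α' > ratio α α' k}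

/-- `I_≥ = I_= ∪ I_>`. -/
def Ige {d : ℕ} (α α' : Fin d → ℝ) : Finset (Fin d) := Ieq α α' ∪ Igt α α'

/-- `q(π_> E)`, the trace of the part of `E` on the directions in `I_>`. -/
def qGt {d : ℕ} (α α' : Fin d → ℝ) : ℝ := ∑ k ∈ Igt α α', 1 / α k

/-! ### The limit field -/

/-- The covariance of fractional Brownian motion with Hurst index `H`. -/
def fbmCov (H t s : ℝ) : ℝ :=
  (|t| ^ (2 * H) + |s| ^ (2 * H) - |t - s| ^ (2 * H)) / 2

/-- The coordinate subspace of the directions in `I`, with coordinates indexed by `I`, is embedded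
in `ℝ^d` by putting `0` in the other directions. Its Lebesgue measure is that of `ℝ^I`. -/
def extendZero {d : ℕ} (I : Finset (Fin d)) (y : I → ℝ) : EuclideanSpace ℝ (Fin d) :=
  WithLp.toLp 2 fun k => if h : k ∈ I then y ⟨k, h⟩ else 0

/-- `(e^{i t y} - 1) conj(e^{i s y} - 1) / (2π |y|²)`. -/
def spectralFactor (t s y : ℝ) : ℂ :=
  (Complex.exp (Complex.I * t * y) - 1) *
    (starRingEnd ℂ) (Complex.exp (Complex.I * s * y) - 1) / (2 * Real.pi * |y| ^ 2 : ℝ)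

/-- The covariance function of the limit field. -/
def limitCov {d : ℕ} (μ : Measure (Site d)) (p : ℝ) (ν : Measure (EuclideanSpace ℝ (Fin d)))
    (α α' : Fin d → ℝ) (t s : EuclideanSpace ℝ (Fin d)) : ℂ :=
  (sigmaSq μ p : ℂ) * (∏ k ∈ Ilt α α', fbmCov (1 / 2) (t k) (s k) : ℝ) *
    (∏ k ∈ Igt α α', t k * s k / (2 * Real.pi) : ℝ) *
    ∫ y : Ige α α' → ℝ, ((‖logCharFun ν (extendZero _ y)‖ ^ (-2 : ℤ) : ℝ) : ℂ) *
      ∏ k ∈ Ieq α α', spectralFactor (t k) (s k) (extendZero _ y k)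

/-- `W` is a zero-mean Gaussian field on `ℝ^d` with the covariance function of the limit field. -/
structure IsLimitField {d : ℕ} (μ : Measure (Site d)) (p : ℝ)
    (ν : Measure (EuclideanSpace ℝ (Fin d))) (α α' : Fin d → ℝ)
    {Ω : Type*} [MeasurableSpace Ω] (P : Measure Ω) (W : EuclideanSpace ℝ (Fin d) → Ω → ℝ) :
    Prop where
  gaussian : IsGaussianProcess W P
  mean_zero : ∀ t, ∫ ω, W t ω ∂P = 0
  cov_eq : ∀ t s, (cov[W t, W s; P] : ℂ) = limitCov μ p ν α α' t s

/-! ### The modulus of continuity -/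

/-- The cube `[0,1]^d`. -/
def unitCube (d : ℕ) : Set (EuclideanSpace ℝ (Fin d)) := {t | ∀ k, t k ∈ Set.Icc (0 : ℝ) 1}

/-- The exponents `H_j` that are allowed in the directions `j ∈ I_=`. -/
structure IsAdmissible {d : ℕ} (α α' H : Fin d → ℝ) : Prop where
  case_a : ∀ j ∈ Ieq α α', ((Igt α α').card = 1 ∨ (Igt α α' = ∅ ∧ α j < 1 / 2)) →
    H j = α j * (1 - qGt α α' / 2) + 1 / 2
  case_b : ∀ j ∈ Ieq α α', Igt α α' = ∅ → α j = 1 / 2 → H j ∈ Set.Ioo (0 : ℝ) 1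
  case_c : ∀ j ∈ Ieq α α', Igt α α' = ∅ → 1 / 2 < α j → H j = 1

/-- The anisotropic distance `ρ`. -/
def aniso {d : ℕ} (α α' H : Fin d → ℝ) (s t : EuclideanSpace ℝ (Fin d)) : ℝ :=
  ∑ j ∈ Igt α α', |t j - s j| + ∑ j ∈ Ilt α α', |t j - s j| ^ (1 / 2 : ℝ) +
    ∑ j ∈ Ieq α α', |t j - s j| ^ H j

end OperatorScaling

end

open OperatorScaling

/-! Everything rests on the variance bound E|W(t) - W(s)|² ≤ C ρ(s,t)² on the cube. For a Gaussian
field it gives, by chaining, the modulus ρ √log(1 + 1/ρ) on the dyadic points, and this passes to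
the extension by limits. The power 1/2 of the logarithm is what is really obtained; the ε only
weakens it (`sqrt_log_le`).

For the variance it is enough to change one coordinate at a time
(`exists_increment_bound_of_coordinates`). Coordinate j enters exactly one of the three factors of
the covariance. For j in I_< this is a Brownian kernel with second difference |t_j - s_j|; for j in
I_> it is a bilinear kernel with second difference a multiple of |t_j - s_j|². For j in I_= the
second difference is the spectral integral with |e^{i t_j y_j} - e^{i s_j y_j}|² in direction j, and
it must be at most a constant times h^{2 H_j} with h = |t_j - s_j| (`exists_spectral_bound`).

The attraction hypothesis makes log ψ homogeneous, log ψ(r^E y) = r log ψ(y), and fullness keeps it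
away from 0 off the origin. Together these give |log ψ(y)| ≥ c |y_k|^{α_k} for every k
(`IsLogCharFun.exists_lower_bound`). Hence |log ψ|^{-2} ≤ C ∏ |y_k|^{-2 α_k θ_k} for all weights θ_k
≥ 0 of sum 1, and the integral splits into one-dimensional ones. A singularity |y_j|^{-b} turns the
power h into h^{1+b}, so θ_j should be as large as the constraint b < 1 permits; this is where α_j
is compared with 1/2. A direction m in I_> has no decay factor of its own. There is at most one, and
it is integrated out first, which is possible because 1/α_m < 2.

On the probabilistic side, the exponential moments of all normalised grid increments are summed into
one almost surely finite variable (`exists_grid_bound`). The chaining is then deterministic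
(`exists_modulus_const`), and Fatou's lemma identifies the limit along the grids with W
(`gridLimit_ae_eq`). -/

noncomputable section

namespace OperatorScaling

/-! ### Operator stability and the lower bound for log ψ -/

/-- The dilation `y ↦ r ^ E y` for `E = diag(1/α_1, …, 1/α_d)`. -/
def dilate {d : ℕ} (α : Fin d → ℝ) (r : ℝ) (y : EuclideanSpace ℝ (Fin d)) :
    EuclideanSpace ℝ (Fin d) :=
  WithLp.toLp 2 fun k => r ^ (1 / α k) * y k

@[simp] lemma dilate_apply {d : ℕ} (α : Fin d → ℝ) (r : ℝ) (y : EuclideanSpace ℝ (Fin d))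
    (k : Fin d) : dilate α r y k = r ^ (1 / α k) * y k := rfl

lemma dilate_dilate {d : ℕ} (α : Fin d → ℝ) {r s : ℝ} (hr : 0 ≤ r) (hs : 0 ≤ s)
    (y : EuclideanSpace ℝ (Fin d)) : dilate α r (dilate α s y) = dilate α (r * s) y := by
  ext k
  simp [Real.mul_rpow hr hs, mul_assoc]

@[simp] lemma dilate_one {d : ℕ} (α : Fin d → ℝ) (y : EuclideanSpace ℝ (Fin d)) :
    dilate α 1 y = y := by
  ext k
  simp

@[simp] lemma dilate_at_zero {d : ℕ} (α : Fin d → ℝ) (r : ℝ) : dilate α r 0 = 0 := by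
  ext k
  simp

lemma dilate_zero {d : ℕ} {α : Fin d → ℝ} (hα : ∀ k, 0 < α k) (y : EuclideanSpace ℝ (Fin d)) :
    dilate α 0 y = 0 := by
  ext k
  simp [Real.zero_rpow (inv_ne_zero (hα k).ne')]

lemma continuous_dilate {d : ℕ} (α : Fin d → ℝ) (r : ℝ) : Continuous (dilate α r) := by
  unfold dilate
  fun_prop

lemma continuous_dilate_scale {d : ℕ} {α : Fin d → ℝ} (hα : ∀ k, 0 < α k)
    (y : EuclideanSpace ℝ (Fin d)) : Continuous fun r : ℝ => dilate α r y := by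
  unfold dilate
  refine (PiLp.continuous_toLp 2 _).comp (continuous_pi fun k => ?_)
  exact (continuous_id.rpow_const fun _ => Or.inr (one_div_pos.2 (hα k)).le).mul continuous_const

/-- The characteristic function of a probability measure on `ℤ^d`, seen as a measure on `ℝ^d`. -/
def siteCharFun {d : ℕ} (μ : Measure (Site d)) (y : EuclideanSpace ℝ (Fin d)) : ℂ :=
  charFun (μ.map fun z => (WithLp.toLp 2 fun k => (z k : ℝ) : EuclideanSpace ℝ (Fin d))) y

/-- The diagonal matrix n^{-E} is self-adjoint and moves onto the argument; independence then gives
an n-th power. -/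
lemma charFun_normalized_sum {d : ℕ} (μ : Measure (Site d)) [IsProbabilityMeasure μ]
    (α : Fin d → ℝ) (n : ℕ) (y : EuclideanSpace ℝ (Fin d)) :
    charFun ((Measure.infinitePi fun _ : ℕ => μ).map fun ξ : ℕ → Site d =>
      (WithLp.toLp 2 fun k => (n : ℝ) ^ (-(1 / α k)) * ∑ i ∈ Finset.range n, (ξ i k : ℝ) :
        EuclideanSpace ℝ (Fin d))) y
      = siteCharFun μ (dilate α ((n : ℝ)⁻¹) y) ^ n := by
  let g : Site d → EuclideanSpace ℝ (Fin d) := fun z => WithLp.toLp 2 fun k => (z k : ℝ)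
  have hg : Measurable g := measurable_of_countable g
  have hsum : charFun ((Measure.infinitePi fun _ : ℕ => μ).map
      fun ξ : ℕ → Site d => ∑ i ∈ Finset.range n, g (ξ i)) (dilate α ((n : ℝ)⁻¹) y)
      = siteCharFun μ (dilate α ((n : ℝ)⁻¹) y) ^ n := by
    have h := (iIndepFun_infinitePi (P := fun _ : ℕ => μ) (X := fun _ => g) fun _ => hg)
    rw [iIndepFun.charFun_map_fun_finsetSum_eq_prod (s := Finset.range n)
      (X := fun i (ξ : ℕ → Site d) => g (ξ i))
      (fun i _ => (hg.comp (measurable_pi_apply i)).aemeasurable) (h.restrict _)]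
    rw [Finset.prod_apply, Finset.prod_congr rfl, Finset.prod_const, Finset.card_range]
    intro i _
    have hmap := Measure.map_map (μ := Measure.infinitePi fun _ : ℕ => μ) hg
      (measurable_pi_apply i)
    rw [Measure.infinitePi_map_eval] at hmap
    exact congrArg (fun m => charFun m _) hmap.symm
  rw [← hsum, charFun_apply, charFun_apply, integral_map, integral_map]
  · congr with ξ
    simp only [PiLp.inner_apply, dilate_apply, WithLp.ofLp_sum, g]
    congr 3
    refine Finset.sum_congr rfl fun k _ => ?_
    simp only [Finset.sum_apply, RCLike.inner_apply, conj_trivial]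
    rw [Real.inv_rpow n.cast_nonneg, Real.rpow_neg n.cast_nonneg]
    ring
  · exact (Finset.measurable_sum _ fun i _ => hg.comp (measurable_pi_apply i)).aemeasurable
  · exact (by fun_prop : Continuous _).aestronglyMeasurable
  · refine Measurable.aemeasurable ?_
    have : Measurable fun z : Site d => fun k => (z k : ℝ) := measurable_of_countable _
    refine (PiLp.continuous_toLp 2 _).measurable.comp (measurable_pi_lambda _ fun k => ?_)
    refine measurable_const.mul (Finset.measurable_sum _ fun i _ => ?_)
    exact (measurable_of_countable (fun z : Site d => (z k : ℝ))).comp (measurable_pi_apply i)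
  · exact (by fun_prop : Continuous _).aestronglyMeasurable

/-- Strict operator stability of the limit law. -/
lemma charFun_dilate_nat {d : ℕ} {μ : Measure (Site d)} [IsProbabilityMeasure μ] {α : Fin d → ℝ}
    {ν : Measure (EuclideanSpace ℝ (Fin d))} [IsProbabilityMeasure ν]
    (h : InDomainOfAttraction μ α ν) {m : ℕ} (hm : m ≠ 0) (y : EuclideanSpace ℝ (Fin d)) :
    charFun ν (dilate α m y) = charFun ν y ^ m := by
  have key : ∀ y, Tendsto (fun n : ℕ => siteCharFun μ (dilate α ((n : ℝ)⁻¹) y) ^ n) atTop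
      (𝓝 (charFun ν y)) := by
    intro y
    have := ProbabilityMeasure.tendsto_iff_tendsto_charFun.1 h.tendsto y
    simp only [ProbabilityMeasure.coe_mk, Measure.map_id] at this
    simpa only [charFun_normalized_sum] using this
  -- Along the subsequence nm the normalisation cancels the dilation, (nm)^{-E} m^E = n^{-E}, so the
  -- same sequence tends to ψ(m^E y) and to ψ(y)^m.
  have h1 := (key (dilate α m y)).comp (tendsto_id.atTop_mul_const' (Nat.pos_of_ne_zero hm))
  refine tendsto_nhds_unique h1 (((key y).pow m).congr fun n => ?_)
  have hm' : (m : ℝ) ≠ 0 := by exact_mod_cast hm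
  simp only [Function.comp_def, id]
  rw [dilate_dilate _ (by positivity) (by positivity), ← pow_mul]
  congr 3
  push_cast
  field_simp

/-- By stability a zero at y forces zeros at all n^{-E} y. These points tend to 0, where ψ is 1. -/
lemma charFun_ne_zero_of_domain {d : ℕ} {μ : Measure (Site d)} [IsProbabilityMeasure μ]
    {α : Fin d → ℝ} (hα : ∀ k, 0 < α k)
    {ν : Measure (EuclideanSpace ℝ (Fin d))} [IsProbabilityMeasure ν]
    (h : InDomainOfAttraction μ α ν) (y : EuclideanSpace ℝ (Fin d)) : charFun ν y ≠ 0 := by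
  intro h0
  have hz : ∀ n : ℕ, charFun ν (dilate α ((n + 1 : ℕ) : ℝ)⁻¹ y) = 0 := by
    intro n
    have := charFun_dilate_nat h n.succ_ne_zero (dilate α ((n + 1 : ℕ) : ℝ)⁻¹ y)
    rw [dilate_dilate _ (by positivity) (by positivity), mul_inv_cancel₀ (by positivity),
      dilate_one, h0] at this
    exact pow_eq_zero_iff (n.succ_ne_zero) |>.1 this.symm
  have hc : Tendsto (fun n : ℕ => charFun ν (dilate α ((n + 1 : ℕ) : ℝ)⁻¹ y)) atTop
      (𝓝 (charFun ν (dilate α 0 y))) := by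
    have hcont : Continuous fun r : ℝ => charFun ν (dilate α r y) :=
      continuous_charFun.comp (continuous_dilate_scale hα y)
    have h0 : Tendsto (fun n : ℕ => (((n + 1 : ℕ) : ℝ))⁻¹) atTop (𝓝 0) :=
      (tendsto_inv_atTop_nhds_zero_nat (𝕜 := ℝ)).comp (tendsto_add_atTop_nat 1)
    exact (hcont.tendsto 0).comp h0
  simp only [hz, dilate_zero hα, charFun_zero] at hc
  simpa using tendsto_nhds_unique hc tendsto_const_nhds

/-- A nowhere vanishing continuous function on the simply connected space ℝ^d lifts through the
covering exp. -/
lemma exists_isLogCharFun {d : ℕ} {ν : Measure (EuclideanSpace ℝ (Fin d))}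
    [IsProbabilityMeasure ν] (hν : ∀ y, charFun ν y ≠ 0) : ∃ L, IsLogCharFun ν L := by
  let f : C(EuclideanSpace ℝ (Fin d), {z : ℂ // z ≠ 0}) :=
    ⟨fun y => ⟨charFun ν y, hν y⟩, continuous_charFun.subtype_mk _⟩
  obtain ⟨F, ⟨h0, hF⟩, -⟩ := Complex.isCoveringMap_exp.existsUnique_continuousMap_lifts f 0 0
    (Subtype.ext (by simp [f]))
  exact ⟨F, F.continuous, h0, fun y => congrArg Subtype.val (congrFun hF y)⟩

lemma isLogCharFun_logCharFun {d : ℕ} {ν : Measure (EuclideanSpace ℝ (Fin d))}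
    (h : ∃ L, IsLogCharFun ν L) : IsLogCharFun ν (logCharFun ν) := by
  rw [logCharFun, dif_pos h]
  exact h.choose_spec

lemma eq_of_exp_eq {E : Type*} [TopologicalSpace E] [PreconnectedSpace E] {f g : E → ℂ}
    (hf : Continuous f) (hg : Continuous g) (h : ∀ y, Complex.exp (f y) = Complex.exp (g y))
    (a : E) (ha : f a = g a) : f = g :=
  Complex.isCoveringMap_exp.eq_of_comp_eq hf hg (funext fun y => Subtype.ext (h y)) a ha

/-- The logarithm of the characteristic function of a strictly operator stable law is
homogeneous. -/
lemma IsLogCharFun.dilate_eq {d : ℕ} {μ : Measure (Site d)} [IsProbabilityMeasure μ]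
    {α : Fin d → ℝ} (hα : ∀ k, 0 < α k)
    {ν : Measure (EuclideanSpace ℝ (Fin d))} [IsProbabilityMeasure ν]
    (h : InDomainOfAttraction μ α ν) {L : EuclideanSpace ℝ (Fin d) → ℂ} (hL : IsLogCharFun ν L)
    {r : ℝ} (hr : 0 ≤ r) (y : EuclideanSpace ℝ (Fin d)) : L (dilate α r y) = r * L y := by
  obtain ⟨hcont, hzero, hexp⟩ := hL
  have hnat : ∀ (m : ℕ) (y), L (dilate α m y) = m * L y := by
    intro m
    rcases eq_or_ne m 0 with rfl | hm
    · intro y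
      simp [dilate_zero hα, hzero]
    refine congrFun (eq_of_exp_eq (hcont.comp (continuous_dilate α m))
      (continuous_const.mul hcont) (fun y => ?_) 0 (by simp [hzero]))
    rw [hexp, charFun_dilate_nat h hm, Complex.exp_nat_mul, hexp]
  -- Homogeneity is meant for nonnegative scales only. Truncation at 0 gives an identity valid at
  -- every rational, with both sides continuous in the scale, so density of ℚ concludes.
  have hrat : ∀ q : ℚ, L (dilate α (max (q : ℝ) 0) y) = (max (q : ℝ) 0 : ℝ) * L y := by
    intro q
    rcases le_total q 0 with hq | hq
    · have : max (q : ℝ) 0 = 0 := max_eq_right (by exact_mod_cast hq)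
      simp [this, dilate_zero hα, hzero]
    · have hq' : max (q : ℝ) 0 = q := max_eq_left (by exact_mod_cast hq)
      have hden : (q.den : ℝ) ≠ 0 := by exact_mod_cast q.den_nz
      have hnum : (q : ℝ) = (q.num.toNat : ℝ) * (q.den : ℝ)⁻¹ := by
        have h1 : ((q.num.toNat : ℤ) : ℝ) = (q.num : ℝ) := by
          rw [Int.toNat_of_nonneg (Rat.num_nonneg.2 hq)]
        rw [Rat.cast_def, div_eq_mul_inv, ← h1, Int.cast_natCast]
      have h2 : L (dilate α ((q.den : ℝ)⁻¹) y) = (q.den : ℂ)⁻¹ * L y := by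
        have := hnat q.den (dilate α ((q.den : ℝ)⁻¹) y)
        rw [dilate_dilate _ (by positivity) (by positivity), mul_inv_cancel₀ hden,
          dilate_one] at this
        rw [this, ← mul_assoc, inv_mul_cancel₀ (by exact_mod_cast q.den_nz), one_mul]
      rw [hq', hnum, ← dilate_dilate _ (by positivity) (by positivity), hnat, h2]
      push_cast
      ring
  have := DenseRange.equalizer (g := fun r : ℝ => L (dilate α (max r 0) y))
    (h := fun r : ℝ => (max r 0 : ℝ) * L y) (Rat.denseRange_cast (𝕜 := ℝ))
    (hcont.comp ((continuous_dilate_scale hα y).comp (continuous_id.max continuous_const)))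
    (by fun_prop) (funext hrat)
  simpa [max_eq_left hr] using congrFun this r

lemma ae_cos_inner_eq_one {d : ℕ} {ν : Measure (EuclideanSpace ℝ (Fin d))}
    [IsProbabilityMeasure ν] {y : EuclideanSpace ℝ (Fin d)} (h : charFun ν y = 1) :
    ∀ᵐ x ∂ν, Real.cos (inner ℝ x y) = 1 := by
  have hint : Integrable (fun x => 1 - Real.cos (inner ℝ x y)) ν := by
    refine Integrable.of_bound (by fun_prop) 2 (ae_of_all _ fun x => ?_)
    have h1 := Real.cos_le_one (inner ℝ x y)
    have h2 := Real.neg_one_le_cos (inner ℝ x y)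
    rw [Real.norm_eq_abs, abs_le]
    constructor <;> linarith
  have hcint : Integrable (fun x => Real.cos (inner ℝ x y)) ν := by
    refine ((integrable_const (1 : ℝ)).sub hint).congr (ae_of_all _ fun x => ?_)
    simp
  have hre : ∫ x, Real.cos (inner ℝ x y) ∂ν = 1 := by
    have h1 : (charFun ν y).re = ∫ x, Real.cos (inner ℝ x y) ∂ν := by
      rw [charFun_apply]
      have := integral_re (μ := ν) (𝕜 := ℂ) (f := fun x => Complex.exp (inner ℝ x y * Complex.I))
        (Integrable.of_bound (by fun_prop) 1 (ae_of_all _ fun x => by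
          rw [Complex.norm_exp_ofReal_mul_I]))
      simp only [RCLike.re_to_complex, Complex.exp_ofReal_mul_I_re] at this
      exact this.symm
    rw [← h1, h, Complex.one_re]
  have h0 : ∫ x, (1 - Real.cos (inner ℝ x y)) ∂ν = 0 := by
    rw [integral_sub (integrable_const _) hcint, hre]
    simp
  have := (integral_eq_zero_iff_of_nonneg
    (fun x => sub_nonneg.2 (Real.cos_le_one (inner ℝ x y))) hint).1 h0
  filter_upwards [this] with x hx
  simp only [Pi.zero_apply] at hx
  linarith

/-- A continuous path in the discrete set 2πℤ is constant. It is phrased as uniqueness of the lift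
of the constant 1 through exp. -/
lemma eq_zero_of_continuous_of_cos_eq_one {g : ℝ → ℝ} (hg : Continuous g) (h0 : g 0 = 0)
    (h : ∀ q : ℚ, Real.cos (g q) = 1) (r : ℝ) : g r = 0 := by
  have hc : ∀ r, Real.cos (g r) = 1 := congrFun (DenseRange.equalizer (g := fun r => Real.cos (g r))
    (h := fun _ => 1) (Rat.denseRange_cast (𝕜 := ℝ)) (by fun_prop) (by fun_prop) (funext h))
  have hexp : ∀ r, Complex.exp ((g r : ℂ) * Complex.I) = Complex.exp 0 := by
    intro r
    have hs : Real.sin (g r) = 0 := by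
      have := Real.sin_sq_add_cos_sq (g r)
      rw [hc r] at this
      nlinarith
    rw [Complex.exp_mul_I, ← Complex.ofReal_cos, ← Complex.ofReal_sin, hc, hs]
    simp
  have := congrFun (eq_of_exp_eq (f := fun r => (g r : ℂ) * Complex.I) (g := fun _ => 0)
    (by fun_prop) (by fun_prop) hexp 0 (by simp [h0])) r
  simpa using this

/-- If log ψ vanishes at y, homogeneity makes ψ equal to 1 on the whole orbit r^E y. For almost
every x the inner product of x with r^E y then stays in 2πℤ, is continuous in r and starts at 0,
hence vanishes at r = 1. So ν is carried by the hyperplane orthogonal to y, against fullness. -/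
lemma IsLogCharFun.ne_zero {d : ℕ} {μ : Measure (Site d)} [IsProbabilityMeasure μ]
    {α : Fin d → ℝ} (hα : ∀ k, 0 < α k)
    {ν : Measure (EuclideanSpace ℝ (Fin d))} [IsProbabilityMeasure ν] (hfull : IsFull ν)
    (h : InDomainOfAttraction μ α ν) {L : EuclideanSpace ℝ (Fin d) → ℂ} (hL : IsLogCharFun ν L)
    {y : EuclideanSpace ℝ (Fin d)} (hy : y ≠ 0) : L y ≠ 0 := by
  intro hLy
  refine hfull y 0 hy ?_
  have hone : ∀ q : ℚ, charFun ν (dilate α (max (q : ℝ) 0) y) = 1 := by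
    intro q
    rw [← hL.2.2, hL.dilate_eq hα h (le_max_right _ _), hLy, mul_zero, Complex.exp_zero]
  filter_upwards [ae_all_iff.2 fun q => ae_cos_inner_eq_one (hone q)] with x hx
  have := eq_zero_of_continuous_of_cos_eq_one
    (g := fun r => inner ℝ x (dilate α (max r 0) y))
    (continuous_const.inner ((continuous_dilate_scale hα y).comp
      (continuous_id.max continuous_const))) (by simp [dilate_zero hα]) hx 1
  simpa [real_inner_comm] using this

/-- The lower bound for the log-characteristic function by the coordinates. -/
lemma IsLogCharFun.exists_lower_bound {d : ℕ} {μ : Measure (Site d)} [IsProbabilityMeasure μ]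
    {α : Fin d → ℝ} (hα : ∀ k, 0 < α k)
    {ν : Measure (EuclideanSpace ℝ (Fin d))} [IsProbabilityMeasure ν] (hfull : IsFull ν)
    (h : InDomainOfAttraction μ α ν) {L : EuclideanSpace ℝ (Fin d) → ℂ} (hL : IsLogCharFun ν L) :
    ∃ c > 0, ∀ (y : EuclideanSpace ℝ (Fin d)) (k : Fin d), c * |y k| ^ α k ≤ ‖L y‖ := by
  -- The constant is the minimum of |log ψ| on the unit sphere; the index k only witnesses that the
  -- sphere is nonempty.
  have key : ∀ k : Fin d, ∃ c > 0, ∀ y : EuclideanSpace ℝ (Fin d), y ∈ Metric.sphere 0 1 → c ≤ ‖L y‖ := by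
    intro k
    have hne : (Metric.sphere (0 : EuclideanSpace ℝ (Fin d)) 1).Nonempty :=
      ⟨EuclideanSpace.single k 1, by simp⟩
    obtain ⟨y₀, hy₀, hmin⟩ := (isCompact_sphere (0 : EuclideanSpace ℝ (Fin d)) 1).exists_isMinOn hne
      hL.1.norm.continuousOn
    refine ⟨‖L y₀‖, norm_pos_iff.2 (hL.ne_zero hα hfull h ?_), fun y hy => hmin hy⟩
    rintro rfl
    simp at hy₀
  rcases Nat.eq_zero_or_pos d with rfl | hd
  · exact ⟨1, one_pos, fun _ k => k.elim0⟩
  obtain ⟨c, hc, hmin⟩ := key ⟨0, hd⟩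
  refine ⟨c, hc, fun y k => ?_⟩
  rcases eq_or_ne (y k) 0 with hk | hk
  · simp [hk, Real.zero_rpow (hα k).ne']
  have hnorm : ∀ z : EuclideanSpace ℝ (Fin d), |z k| ≤ ‖z‖ := fun z => by
    simpa using PiLp.norm_apply_le z k
  let f : ℝ → ℝ := fun r => ‖dilate α r y‖
  have hf : Continuous f := (continuous_dilate_scale hα y).norm
  -- At scale R the k-th coordinate of R^E y has modulus 1, so the orbit has met the unit sphere at
  -- some r ≤ R.
  set R : ℝ := |y k| ^ (-α k) with hR
  have hRpos : 0 < R := by positivity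
  have hfR : 1 ≤ f R := by
    refine le_trans (le_of_eq ?_) (hnorm (dilate α R y))
    rw [dilate_apply, abs_mul, abs_of_nonneg (by positivity), hR, ← Real.rpow_mul (abs_nonneg _)]
    rw [show -α k * (1 / α k) = -1 by have := (hα k).ne'; field_simp, Real.rpow_neg_one,
      inv_mul_cancel₀ (abs_ne_zero.2 hk)]
  obtain ⟨r, ⟨hr0, hrR⟩, hr⟩ := intermediate_value_Icc hRpos.le hf.continuousOn
    (show (1 : ℝ) ∈ Set.Icc (f 0) (f R) from ⟨by simp [f, dilate_zero hα], hfR⟩)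
  have h1 : c ≤ r * ‖L y‖ := by
    have := hmin (dilate α r y) (by simpa [f] using hr)
    rw [hL.dilate_eq hα h hr0, norm_mul, Complex.norm_real, Real.norm_of_nonneg hr0] at this
    exact this
  have h2 : c ≤ R * ‖L y‖ := h1.trans (by gcongr)
  rw [hR, Real.rpow_neg (abs_nonneg _)] at h2
  have h3 : 0 < |y k| ^ α k := by positivity
  rwa [inv_mul_eq_div, le_div_iff₀ h3] at h2

/-! ### One-dimensional integrals of powers -/

lemma lintegral_comp_abs (f : ℝ → ENNReal) :
    ∫⁻ x : ℝ, f |x| = 2 * ∫⁻ x in Set.Ioi 0, f x := by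
  have h1 : ∫⁻ x in Set.Ioi (0 : ℝ), f |x| = ∫⁻ x in Set.Ioi 0, f x :=
    setLIntegral_congr_fun measurableSet_Ioi fun x hx => by rw [abs_of_pos hx]
  have h2 : ∫⁻ x in Set.Iio (0 : ℝ), f |x| = ∫⁻ x in Set.Ioi 0, f x := by
    rw [← h1, ← (Measure.measurePreserving_neg (volume : Measure ℝ)).setLIntegral_comp_preimage_emb
      (MeasurableEquiv.neg ℝ).measurableEmbedding]
    simp
  rw [← lintegral_add_compl (fun x => f |x|) (measurableSet_Ioi (a := (0 : ℝ))), h1,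
    Set.compl_Ioi, setLIntegral_congr Iio_ae_eq_Iic.symm, h2, two_mul]

lemma lintegral_Ioc_rpow {p R : ℝ} (hp : p < 1) (hR : 0 < R) :
    ∫⁻ x in Set.Ioc 0 R, ENNReal.ofReal (x ^ (-p)) = ENNReal.ofReal (R ^ (1 - p) / (1 - p)) := by
  have hi : IntervalIntegrable (fun x : ℝ => x ^ (-p)) volume 0 R :=
    intervalIntegral.intervalIntegrable_rpow' (by linarith)
  rw [← ofReal_integral_eq_lintegral_ofReal
    ((intervalIntegrable_iff_integrableOn_Ioc_of_le hR.le).1 hi)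
    ((ae_restrict_mem measurableSet_Ioc).mono fun x hx => Real.rpow_nonneg hx.1.le _),
    ← intervalIntegral.integral_of_le hR.le, integral_rpow (Or.inl (by linarith)),
    Real.zero_rpow (by linarith), sub_zero, show -p + 1 = 1 - p by ring]

lemma lintegral_Ioi_rpow {q R : ℝ} (hq : 1 < q) (hR : 0 < R) :
    ∫⁻ x in Set.Ioi R, ENNReal.ofReal (x ^ (-q)) = ENNReal.ofReal (R ^ (1 - q) / (q - 1)) := by
  rw [← ofReal_integral_eq_lintegral_ofReal (integrableOn_Ioi_rpow_of_lt (by linarith) hR)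
    ((ae_restrict_mem measurableSet_Ioi).mono fun x hx => Real.rpow_nonneg (hR.trans hx).le _),
    integral_Ioi_rpow_of_lt (by linarith) hR, show -q + 1 = 1 - q by ring, neg_div,
    ← div_neg, neg_sub]

/-- The minimum is replaced by its first term up to R and by its second beyond. The radius is left
free so that it can be put near the crossover of the two powers. -/
lemma lintegral_min_rpow_le {A B R p q : ℝ} (hA : 0 ≤ A) (hB : 0 ≤ B) (hR : 0 < R) (hp : p < 1)
    (hq : 1 < q) :
    ∫⁻ y : ℝ, ENNReal.ofReal (min (A * |y| ^ (-p)) (B * |y| ^ (-q))) ≤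
      ENNReal.ofReal (2 * (A * (R ^ (1 - p) / (1 - p)) + B * (R ^ (1 - q) / (q - 1)))) := by
  have h1 : 0 ≤ A * (R ^ (1 - p) / (1 - p)) :=
    mul_nonneg hA (div_nonneg (by positivity) (by linarith))
  have h2 : 0 ≤ B * (R ^ (1 - q) / (q - 1)) :=
    mul_nonneg hB (div_nonneg (by positivity) (by linarith))
  rw [lintegral_comp_abs (fun y => ENNReal.ofReal (min (A * y ^ (-p)) (B * y ^ (-q)))),
    ENNReal.ofReal_mul (by norm_num), ENNReal.ofReal_ofNat, ENNReal.ofReal_add h1 h2,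
    ENNReal.ofReal_mul hA, ENNReal.ofReal_mul hB, ← lintegral_Ioc_rpow hp hR,
    ← lintegral_Ioi_rpow hq hR, ← lintegral_const_mul' _ _ ENNReal.ofReal_ne_top,
    ← lintegral_const_mul' _ _ ENNReal.ofReal_ne_top, ← Set.Ioc_union_Ioi_eq_Ioi hR.le]
  refine mul_le_mul_right (lintegral_union_le _ _ _ |>.trans (add_le_add ?_ ?_)) _
  · refine lintegral_mono fun y => ?_
    rw [← ENNReal.ofReal_mul hA]
    exact ENNReal.ofReal_le_ofReal (min_le_left _ _)
  · refine lintegral_mono fun y => ?_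
    rw [← ENNReal.ofReal_mul hB]
    exact ENNReal.ofReal_le_ofReal (min_le_right _ _)

/-- The function `y ↦ min (h², 4 / y²)`, which dominates `|e^{i t y} - e^{i s y}|²` for
`|t - s| ≤ h`. -/
def increDecay (h y : ℝ) : ℝ := min (h ^ 2) (4 * |y| ^ (-2 : ℝ))

lemma increDecay_nonneg (h y : ℝ) : 0 ≤ increDecay h y :=
  le_min (sq_nonneg h) (by positivity)

@[fun_prop]
lemma measurable_increDecay (h : ℝ) : Measurable (increDecay h) := by
  unfold increDecay
  fun_prop

/-- The constant in `lintegral_rpow_mul_increDecay_le`. -/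
def decayConst (b : ℝ) : ℝ := 2 * (1 / (1 - b) + 4 / (1 + b))

lemma decayConst_nonneg {b : ℝ} (hb : 0 ≤ b) (hb' : b < 1) : 0 ≤ decayConst b := by
  have : 0 < 1 - b := by linarith
  unfold decayConst
  positivity

/-- The power of h is dictated by the scaling y = u / h. The condition b < 1 is integrability at the
origin; at infinity the decay has order b + 2. A singular weight thus improves h to h^{1+b}. -/
lemma lintegral_rpow_mul_increDecay_le {b h : ℝ} (hb : 0 ≤ b) (hb' : b < 1) (hh : 0 ≤ h) :
    ∫⁻ y : ℝ, ENNReal.ofReal (|y| ^ (-b) * increDecay h y) ≤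
      ENNReal.ofReal (decayConst b * h ^ (1 + b)) := by
  rcases hh.eq_or_lt with rfl | hh
  · have : ∀ y, increDecay 0 y = 0 := fun y => by
      simp only [increDecay, ne_eq, OfNat.ofNat_ne_zero, not_false_eq_true, zero_pow]
      exact min_eq_left (by positivity)
    simp [this]
  calc ∫⁻ y : ℝ, ENNReal.ofReal (|y| ^ (-b) * increDecay h y)
      = ∫⁻ y : ℝ, ENNReal.ofReal (min (h ^ 2 * |y| ^ (-b)) (4 * |y| ^ (-(b + 2)))) := by
        refine lintegral_congr_ae ?_
        filter_upwards [Measure.ae_ne volume 0] with y hy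
        rw [increDecay, mul_min_of_nonneg _ _ (by positivity), mul_comm, mul_left_comm,
          ← Real.rpow_add (abs_pos.2 hy), neg_add]
    _ ≤ _ := lintegral_min_rpow_le (R := h⁻¹) (by positivity) (by norm_num) (by positivity) hb'
        (by linarith)
    _ = _ := by
        congr 1
        have h1 : 1 - b ≠ 0 := by linarith
        have h2 : 1 + b ≠ 0 := by linarith
        rw [Real.inv_rpow hh.le, Real.inv_rpow hh.le, ← Real.rpow_neg hh.le, ← Real.rpow_neg hh.le,
          show h ^ 2 = h ^ (2 : ℝ) by simp, show -(1 - (b + 2)) = 1 + b by ring, decayConst]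
        have : h ^ (2 : ℝ) * (h ^ (-(1 - b)) / (1 - b)) = h ^ (1 + b) * (1 / (1 - b)) := by
          rw [mul_div_assoc', ← Real.rpow_add hh]
          ring_nf
        rw [this, show b + 2 - 1 = 1 + b by ring]
        ring

lemma lintegral_prod_ofReal_le {ι : Type*} [Fintype ι] {g : ι → ℝ → ℝ} (hg : ∀ k y, 0 ≤ g k y)
    (hm : ∀ k, Measurable (g k)) {c : ι → ℝ} (hc : ∀ k, 0 ≤ c k)
    (h : ∀ k, ∫⁻ y, ENNReal.ofReal (g k y) ≤ ENNReal.ofReal (c k)) :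
    ∫⁻ y : ι → ℝ, ENNReal.ofReal (∏ k, g k (y k)) ≤ ENNReal.ofReal (∏ k, c k) := by
  have hint : ∀ k, Integrable (g k) := fun k => by
    refine ⟨(hm k).aestronglyMeasurable, ?_⟩
    rw [hasFiniteIntegral_iff_ofReal (ae_of_all _ (hg k))]
    exact (h k).trans_lt ENNReal.ofReal_lt_top
  have hle : ∀ k, ∫ y, g k y ≤ c k := fun k => by
    rw [← ENNReal.ofReal_le_ofReal_iff (hc k),
      ofReal_integral_eq_lintegral_ofReal (hint k) (ae_of_all _ (hg k))]
    exact h k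
  rw [volume_pi, ← ofReal_integral_eq_lintegral_ofReal (Integrable.fintype_prod hint)
    (ae_of_all _ fun y => Finset.prod_nonneg fun k _ => hg k (y k)),
    integral_fintype_prod_eq_prod]
  exact ENNReal.ofReal_le_ofReal
    (Finset.prod_le_prod (fun k _ => integral_nonneg (hg k)) fun k _ => hle k)

/-- A quantity below all `x_k` is below their weighted geometric mean. -/
lemma le_prod_rpow_of_forall_le {ι : Type*} [Fintype ι] {w C : ℝ} (hw : 0 ≤ w) (hC : 0 ≤ C)
    {x θ : ι → ℝ} (hx : ∀ k, 0 ≤ x k) (hθ : ∀ k, 0 ≤ θ k) (hsum : ∑ k, θ k = 1)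
    (h : ∀ k, θ k ≠ 0 → w ≤ C * x k) : w ≤ C * ∏ k, x k ^ θ k := by
  have h1 : ∏ k, w ^ θ k ≤ ∏ k, (C * x k) ^ θ k := by
    refine Finset.prod_le_prod (fun k _ => by positivity) fun k _ => ?_
    rcases eq_or_ne (θ k) 0 with h0 | h0
    · simp [h0]
    · exact Real.rpow_le_rpow hw (h k h0) (hθ k)
  have h2 : ∀ a : ℝ, 0 ≤ a → ∏ k, a ^ θ k = a := fun a ha => by
    rw [← Real.rpow_sum_of_nonneg ha fun k _ => hθ k, hsum, Real.rpow_one]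
  rw [h2 w hw] at h1
  refine h1.trans (le_of_eq ?_)
  simp_rw [fun k => Real.mul_rpow (z := θ k) hC (hx k)]
  rw [Finset.prod_mul_distrib, h2 C hC]

/-! ### Integrals against a weight bounded in each coordinate -/

section Weight

variable {ι : Type*} [Fintype ι] {w : (ι → ℝ) → ℝ} {C : ℝ} {α θ h : ι → ℝ}

/-- The weights θ distribute the singularity of w over the coordinates by a geometric mean. The
integral then factorises, and `hθα` is integrability at the origin in each coordinate. -/
lemma lintegral_weight_le (hw : ∀ y, 0 ≤ w y) (hC : 0 ≤ C)
    (hwC : ∀ y k, y k ≠ 0 → w y ≤ C * |y k| ^ (-(2 * α k))) (hα : ∀ k, 0 < α k)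
    (hθ : ∀ k, 0 ≤ θ k) (hsum : ∑ k, θ k = 1) (hθα : ∀ k, 2 * α k * θ k < 1) (hh : ∀ k, 0 ≤ h k) :
    ∫⁻ y, ENNReal.ofReal (w y * ∏ k, increDecay (h k) (y k)) ≤
      ENNReal.ofReal (C * ∏ k, decayConst (2 * α k * θ k) * h k ^ (1 + 2 * α k * θ k)) := by
  have hb : ∀ k, 0 ≤ 2 * α k * θ k := fun k => by have := hα k; have := hθ k; positivity
  calc ∫⁻ y, ENNReal.ofReal (w y * ∏ k, increDecay (h k) (y k))
      ≤ ∫⁻ y : ι → ℝ, ENNReal.ofReal C *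
          ENNReal.ofReal (∏ k, |y k| ^ (-(2 * α k * θ k)) * increDecay (h k) (y k)) := by
        refine lintegral_mono_ae ?_
        filter_upwards [ae_all_iff.2 fun k => Measure.ae_eval_ne (μ := fun _ : ι => volume) k 0]
          with y hy
        rw [← ENNReal.ofReal_mul hC, Finset.prod_mul_distrib, ← mul_assoc]
        refine ENNReal.ofReal_le_ofReal (mul_le_mul_of_nonneg_right ?_
          (Finset.prod_nonneg fun k _ => increDecay_nonneg _ _))
        have := le_prod_rpow_of_forall_le (hw y) hC (x := fun k => |y k| ^ (-(2 * α k)))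
          (fun k => by positivity) hθ hsum fun k _ => hwC y k (hy k)
        simp_rw [← Real.rpow_mul (abs_nonneg _), neg_mul] at this
        exact this
    _ = ENNReal.ofReal C * ∫⁻ y : ι → ℝ,
          ENNReal.ofReal (∏ k, |y k| ^ (-(2 * α k * θ k)) * increDecay (h k) (y k)) :=
        lintegral_const_mul' _ _ ENNReal.ofReal_ne_top
    _ ≤ _ := by
        rw [ENNReal.ofReal_mul hC]
        refine mul_le_mul_right (lintegral_prod_ofReal_le
          (g := fun k y => |y| ^ (-(2 * α k * θ k)) * increDecay (h k) y)
          (fun k y => mul_nonneg (by positivity) (increDecay_nonneg _ _)) (fun k => by fun_prop)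
          (fun k => mul_nonneg (decayConst_nonneg (hb k) (hθα k)) (Real.rpow_nonneg (hh k) _))
          fun k => lintegral_rpow_mul_increDecay_le (hb k) (hθα k) (hh k)) _

variable [DecidableEq ι]

lemma lintegral_le_of_lintegral_update_le {f g : (ι → ℝ) → ENNReal} (hf : Measurable f)
    (hg : Measurable g) (m : ι)
    (hfg : ∀ x, ∫⁻ t, f (Function.update x m t) ≤ ∫⁻ t, g (Function.update x m t)) :
    ∫⁻ y, f y ≤ ∫⁻ y, g y := by
  refine lintegral_le_of_lmarginal_le (μ := fun _ : ι => volume) {m} hf hg fun x => ?_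
  simpa only [lmarginal_singleton] using hfg x

/-- The constant that comes from the integration over a coordinate without decay. -/
def tailConst (a : ℝ) : ℝ := 2 * (1 + 1 / (2 * a - 1))

lemma tailConst_nonneg {a : ℝ} (ha : 1 / 2 < a) : 0 ≤ tailConst a := by
  have : 0 < 2 * a - 1 := by linarith
  unfold tailConst
  positivity

/-- The cut is at |t| = D^{-1/(2a)}, where the two bounds agree; decay at infinity uses 2a > 1. -/
lemma lintegral_min_const_le {a C D : ℝ} (ha : 1 / 2 < a) (hC : 0 ≤ C) (hD : 0 < D) :
    ∫⁻ t : ℝ, ENNReal.ofReal (min (C * D) (C * |t| ^ (-(2 * a)))) ≤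
      ENNReal.ofReal (C * tailConst a * D ^ (1 - 1 / (2 * a))) := by
  have h := lintegral_min_rpow_le (A := C * D) (B := C) (p := 0) (q := 2 * a)
    (R := D ^ (-(1 / (2 * a)))) (by positivity) hC (by positivity) one_pos (by linarith)
  simp only [neg_zero, Real.rpow_zero, mul_one, sub_zero, Real.rpow_one, div_one] at h
  refine h.trans (le_of_eq ?_)
  congr 1
  have h1 : D * D ^ (-(1 / (2 * a))) = D ^ (1 - 1 / (2 * a)) := by
    rw [sub_eq_add_neg, Real.rpow_add hD, Real.rpow_one]
  have h2 : (D ^ (-(1 / (2 * a)))) ^ (1 - 2 * a) = D ^ (1 - 1 / (2 * a)) := by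
    rw [← Real.rpow_mul hD.le]
    congr 1
    field_simp
    ring
  rw [mul_assoc, h1, h2, tailConst]
  ring

/-- Coordinate m has no decay factor, so only w itself decays there, like |y_m|^{-2 α_m} with 2 α_m
> 1. With D the geometric mean over the other coordinates, integrating out y_m leaves D^{1 - 1/(2
α_m)}. This lowers the singularities from 2 α_k θ_k to (2 - 1/α_m) α_k θ_k. -/
lemma lintegral_weight_erase_le (hwm : Measurable w) (hw : ∀ y, 0 ≤ w y) (hC : 0 ≤ C)
    (hwC : ∀ y k, y k ≠ 0 → w y ≤ C * |y k| ^ (-(2 * α k))) (hα : ∀ k, 0 < α k)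
    (hθ : ∀ k, 0 ≤ θ k) (hsum : ∑ k, θ k = 1) {m : ι} (hm : θ m = 0) (hαm : 1 / 2 < α m)
    (hθα : ∀ k, (2 - 1 / α m) * α k * θ k < 1) (hh : ∀ k, 0 ≤ h k) :
    ∫⁻ y, ENNReal.ofReal (w y * ∏ k ∈ Finset.univ.erase m, increDecay (h k) (y k)) ≤
      ENNReal.ofReal (C * tailConst (α m) * ∏ k ∈ Finset.univ.erase m,
        decayConst ((2 - 1 / α m) * α k * θ k) * h k ^ (1 + (2 - 1 / α m) * α k * θ k)) := by
  set r : ℝ := 2 - 1 / α m with hr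
  have hr0 : 0 < r := by
    have : 1 / α m < 2 := by
      rw [div_lt_iff₀ (hα m)]
      linarith
    linarith
  have hb : ∀ k, 0 ≤ r * α k * θ k := fun k => by have := hα k; have := hθ k; positivity
  have hCt : 0 ≤ C * tailConst (α m) := mul_nonneg hC (tailConst_nonneg hαm)
  -- In the coordinate already integrated out, the indicator of [0,1] is a dummy factor of integral
  -- 1; it makes the bound a product over all coordinates.
  let φ : ι → ℝ → ℝ := fun k y => if k = m then Set.indicator (Set.Icc 0 1) 1 y else
    |y| ^ (-(r * α k * θ k)) * increDecay (h k) y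
  have hφm : ∀ k, Measurable (φ k) := fun k => by
    by_cases hk : k = m
    · simp only [φ, hk, if_true]
      exact measurable_one.indicator measurableSet_Icc
    · simp only [φ, hk, if_false]
      fun_prop
  have hφ0 : ∀ k y, 0 ≤ φ k y := fun k y => by
    simp only [φ]
    split_ifs
    · exact Set.indicator_nonneg (fun _ _ => zero_le_one) _
    · exact mul_nonneg (by positivity) (increDecay_nonneg _ _)
  -- The bounds on w hold only at nonzero coordinates. Since the comparison below is made for every
  -- fibre, the null set of exceptional points is removed beforehand.
  let S : Set (ι → ℝ) := {y | ∀ k, y k ≠ 0}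
  have hS : MeasurableSet S := by
    have : S = ⋂ k, {y : ι → ℝ | y k ≠ 0} := by ext; simp [S]
    rw [this]
    exact MeasurableSet.iInter fun k =>
      (measurableSet_eq_fun (measurable_pi_apply k) measurable_const).compl
  have hfm : Measurable fun y : ι → ℝ =>
      ENNReal.ofReal (w y * ∏ k ∈ Finset.univ.erase m, increDecay (h k) (y k)) := by fun_prop
  calc ∫⁻ y, ENNReal.ofReal (w y * ∏ k ∈ Finset.univ.erase m, increDecay (h k) (y k))
      = ∫⁻ y, S.indicator (fun y => ENNReal.ofReal
          (w y * ∏ k ∈ Finset.univ.erase m, increDecay (h k) (y k))) y := by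
        refine lintegral_congr_ae ?_
        filter_upwards [ae_all_iff.2 fun k => Measure.ae_eval_ne (μ := fun _ : ι => volume) k 0]
          with y hy
        have hyS : y ∈ S := hy
        rw [Set.indicator_of_mem hyS]
    _ ≤ ∫⁻ y : ι → ℝ, ENNReal.ofReal (C * tailConst (α m)) * ENNReal.ofReal (∏ k, φ k (y k)) := by
        refine lintegral_le_of_lintegral_update_le (hfm.indicator hS)
          (by fun_prop) m fun x => ?_
        by_cases hx : ∃ k, k ≠ m ∧ x k = 0
        · obtain ⟨k, hkm, hk⟩ := hx
          have : ∀ t, Function.update x m t ∉ S := fun t ht => ht k (by simp [hkm, hk])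
          simp [Set.indicator_of_notMem (this _)]
        push Not at hx
        set Q : ℝ := ∏ k ∈ Finset.univ.erase m, increDecay (h k) (x k) with hQ
        have hQ0 : 0 ≤ Q := Finset.prod_nonneg fun k _ => increDecay_nonneg _ _
        set D : ℝ := ∏ k ∈ Finset.univ.erase m, |x k| ^ (-(2 * α k * θ k)) with hD
        have hD0 : 0 < D := Finset.prod_pos fun k hk =>
          Real.rpow_pos_of_pos (abs_pos.2 (hx k (Finset.ne_of_mem_erase hk))) _
        have hprod : ∀ (F : ι → ℝ → ℝ) (t : ℝ),
            ∏ k ∈ Finset.univ.erase m, F k (Function.update x m t k)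
              = ∏ k ∈ Finset.univ.erase m, F k (x k) := fun F t =>
          Finset.prod_congr rfl fun k hk => by
            rw [Function.update_of_ne (Finset.ne_of_mem_erase hk)]
        have hDr : D ^ (1 - 1 / (2 * α m)) =
            ∏ k ∈ Finset.univ.erase m, |x k| ^ (-(r * α k * θ k)) := by
          rw [hD, ← Real.finsetProd_rpow _ _ fun k _ => by positivity]
          refine Finset.prod_congr rfl fun k _ => ?_
          rw [← Real.rpow_mul (abs_nonneg _)]
          congr 1
          have := (hα m).ne'
          rw [hr]
          field_simp
        calc ∫⁻ t, S.indicator (fun y => ENNReal.ofReal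
              (w y * ∏ k ∈ Finset.univ.erase m, increDecay (h k) (y k))) (Function.update x m t)
            ≤ ∫⁻ t, ENNReal.ofReal (min (C * D) (C * |t| ^ (-(2 * α m)))) * ENNReal.ofReal Q := by
              refine lintegral_mono_ae ?_
              filter_upwards [Measure.ae_ne volume 0] with t ht
              refine (Set.indicator_le_self _ _ _).trans ?_
              rw [hprod (fun k => increDecay (h k)), ← hQ, ← ENNReal.ofReal_mul (by positivity)]
              refine ENNReal.ofReal_le_ofReal (mul_le_mul_of_nonneg_right (le_min ?_ ?_) hQ0)
              · have := le_prod_rpow_of_forall_le (hw (Function.update x m t)) hC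
                  (x := fun k => |Function.update x m t k| ^ (-(2 * α k)))
                  (fun k => by positivity) hθ hsum fun k hk => by
                    have hkm : k ≠ m := by rintro rfl; exact hk hm
                    exact hwC _ k (by rw [Function.update_of_ne hkm]; exact hx k hkm)
                simp_rw [← Real.rpow_mul (abs_nonneg _), neg_mul] at this
                rw [← Finset.mul_prod_erase _ _ (Finset.mem_univ m),
                  hprod (fun k y => |y| ^ (-(2 * α k * θ k)))] at this
                simpa [hm] using this
              · simpa using hwC (Function.update x m t) m (by simpa using ht)
          _ = (∫⁻ t, ENNReal.ofReal (min (C * D) (C * |t| ^ (-(2 * α m))))) * ENNReal.ofReal Q :=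
              lintegral_mul_const' _ _ ENNReal.ofReal_ne_top
          _ ≤ ENNReal.ofReal (C * tailConst (α m) * D ^ (1 - 1 / (2 * α m))) *
                ENNReal.ofReal Q := mul_le_mul_left (lintegral_min_const_le hαm hC hD0) _
          _ = ∫⁻ t, ENNReal.ofReal (C * tailConst (α m)) *
                ENNReal.ofReal (∏ k, φ k (Function.update x m t k)) := by
              have : ∀ t, ENNReal.ofReal (∏ k, φ k (Function.update x m t k)) =
                  Set.indicator (Set.Icc 0 1) 1 t *
                    ENNReal.ofReal (D ^ (1 - 1 / (2 * α m)) * Q) := fun t => by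
                rw [← Finset.mul_prod_erase _ _ (Finset.mem_univ m), hprod φ,
                  ENNReal.ofReal_mul (hφ0 _ _), hDr, hQ, ← Finset.prod_mul_distrib]
                congr 1
                · by_cases ht : t ∈ Set.Icc (0 : ℝ) 1 <;> simp [φ, ht]
                · congr 1
                  refine Finset.prod_congr rfl fun k hk => ?_
                  simp [φ, Finset.ne_of_mem_erase hk]
              simp_rw [this]
              rw [lintegral_const_mul' _ _ ENNReal.ofReal_ne_top,
                lintegral_mul_const' _ _ ENNReal.ofReal_ne_top,
                lintegral_indicator_one measurableSet_Icc, Real.volume_Icc, ENNReal.ofReal_mul hCt,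
                ENNReal.ofReal_mul (p := D ^ (1 - 1 / (2 * α m))) (by positivity)]
              simp [mul_assoc]
    _ = ENNReal.ofReal (C * tailConst (α m)) * ∫⁻ y : ι → ℝ, ENNReal.ofReal (∏ k, φ k (y k)) :=
        lintegral_const_mul' _ _ ENNReal.ofReal_ne_top
    _ ≤ _ := by
        rw [ENNReal.ofReal_mul hCt]
        refine mul_le_mul_right ?_ _
        have := lintegral_prod_ofReal_le hφ0 hφm (c := fun k => if k = m then 1 else
          decayConst (r * α k * θ k) * h k ^ (1 + r * α k * θ k)) (fun k => by
            split_ifs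
            · exact zero_le_one
            · exact mul_nonneg (decayConst_nonneg (hb k) (hθα k)) (Real.rpow_nonneg (hh k) _))
          (fun k => by
            by_cases hk : k = m
            · simp only [φ, hk, if_true]
              have : ∀ y : ℝ, ENNReal.ofReal (Set.indicator (Set.Icc 0 1) 1 y) =
                  Set.indicator (Set.Icc 0 1) 1 y := fun y => by
                by_cases hy : y ∈ Set.Icc (0 : ℝ) 1 <;> simp [hy]
              simp_rw [this]
              rw [lintegral_indicator_one measurableSet_Icc]
              simp
            · simp only [φ, hk, if_false]
              exact lintegral_rpow_mul_increDecay_le (hb k) (hθα k) (hh k))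
        refine this.trans (le_of_eq ?_)
        rw [← Finset.mul_prod_erase _ _ (Finset.mem_univ m)]
        simp only [if_true, one_mul]
        congr 1
        refine Finset.prod_congr rfl fun k hk => ?_
        simp [Finset.ne_of_mem_erase hk]

end Weight

/-! ### The power of h in each regime -/

section SpectralIntegral

variable {ι : Type*} [Fintype ι] [DecidableEq ι] {w : (ι → ℝ) → ℝ} {C : ℝ} {α : ι → ℝ}

lemma prod_mul_ite_rpow {ι : Type*} [DecidableEq ι] (J : Finset ι) {j : ι} (hj : j ∈ J) (D e : ι → ℝ) (h : ℝ) :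
    ∏ k ∈ J, D k * (if k = j then h else 1) ^ e k = (∏ k ∈ J, D k) * h ^ e j := by
  rw [Finset.prod_mul_distrib]
  congr 1
  rw [Finset.prod_eq_single_of_mem j hj fun k _ hk => by simp [hk]]
  simp

lemma ite_one_nonneg {ι : Type*} [DecidableEq ι] {j : ι} {h : ℝ} (hh : 0 ≤ h) (k : ι) : 0 ≤ if k = j then h else (1 : ℝ) := by
  split_ifs
  exacts [hh, zero_le_one]

/-- All the weight θ goes to j. The resulting singularity (2 - 1/α_m) α_j is below 1 because both
factors are. -/
lemma exists_bound_of_compl_eq_singleton (hwm : Measurable w) (hw : ∀ y, 0 ≤ w y) (hC : 0 ≤ C)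
    (hwC : ∀ y k, y k ≠ 0 → w y ≤ C * |y k| ^ (-(2 * α k))) (hα : ∀ k, 0 < α k)
    (hα' : ∀ k, α k < 1) {m : ι} (hm : 1 / 2 < α m) {j : ι} (hj : j ≠ m) :
    ∃ K, ∀ h ∈ Set.Icc (0 : ℝ) 1,
      ∫⁻ y, ENNReal.ofReal (w y * ∏ k ∈ Finset.univ.erase m,
        increDecay (if k = j then h else 1) (y k)) ≤
      ENNReal.ofReal (K * h ^ (1 + (2 - 1 / α m) * α j)) := by
  have hr : 0 < 2 - 1 / α m ∧ 2 - 1 / α m < 1 := by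
    have h1 : 1 / α m < 2 := by
      rw [div_lt_iff₀ (hα m)]
      linarith
    have h2 : 1 < 1 / α m := (one_lt_div (hα m)).2 (hα' m)
    constructor <;> linarith
  refine ⟨C * tailConst (α m) * ∏ k ∈ Finset.univ.erase m,
    decayConst ((2 - 1 / α m) * α k * (Pi.single j 1 : ι → ℝ) k), fun h hh => ?_⟩
  refine (lintegral_weight_erase_le (θ := Pi.single j 1) hwm hw hC hwC hα (fun k => ?_) (by simp)
    (by simp [hj.symm]) hm (fun k => ?_) (ite_one_nonneg hh.1)).trans (le_of_eq ?_)
  · by_cases hk : k = j <;> simp [hk]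
  · by_cases hk : k = j
    · subst hk
      have := hα k
      have := hα' k
      simp only [Pi.single_eq_same, mul_one]
      nlinarith
    · simp [hk]
  · rw [prod_mul_ite_rpow _ (Finset.mem_erase.2 ⟨hj, Finset.mem_univ j⟩), ← mul_assoc]
    simp

/-- All the weight θ can go to j, since the singularity 2 α_j is still integrable. -/
lemma exists_bound_of_lt_half (hw : ∀ y, 0 ≤ w y) (hC : 0 ≤ C)
    (hwC : ∀ y k, y k ≠ 0 → w y ≤ C * |y k| ^ (-(2 * α k))) (hα : ∀ k, 0 < α k)
    {j : ι} (hj : α j < 1 / 2) :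
    ∃ K, ∀ h ∈ Set.Icc (0 : ℝ) 1,
      ∫⁻ y, ENNReal.ofReal (w y * ∏ k, increDecay (if k = j then h else 1) (y k)) ≤
      ENNReal.ofReal (K * h ^ (1 + 2 * α j)) := by
  refine ⟨C * ∏ k, decayConst (2 * α k * (Pi.single j 1 : ι → ℝ) k), fun h hh => ?_⟩
  refine (lintegral_weight_le (θ := Pi.single j 1) hw hC hwC hα (fun k => ?_) (by simp)
    (fun k => ?_) (ite_one_nonneg hh.1)).trans (le_of_eq ?_)
  · by_cases hk : k = j <;> simp [hk]
  · by_cases hk : k = j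
    · subst hk
      simp only [Pi.single_eq_same, mul_one]
      linarith
    · simp [hk]
  · rw [prod_mul_ite_rpow _ (Finset.mem_univ j), ← mul_assoc]
    simp

/-- Full weight on j would give the non-integrable singularity |y_j|^{-1}. A weight τ < 1 is used
instead, and the rest goes to a second coordinate, which exists because 1/α_j alone equals 2. -/
lemma exists_bound_of_eq_half (hw : ∀ y, 0 ≤ w y) (hC : 0 ≤ C)
    (hwC : ∀ y k, y k ≠ 0 → w y ≤ C * |y k| ^ (-(2 * α k))) (hα : ∀ k, 0 < α k)
    (hα' : ∀ k, α k < 1) (hsum : 2 < ∑ k, 1 / α k) {j : ι} (hj : α j = 1 / 2) {H : ℝ}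
    (hH : H < 1) :
    ∃ K, 0 ≤ K ∧ ∀ h ∈ Set.Icc (0 : ℝ) 1,
      ∫⁻ y, ENNReal.ofReal (w y * ∏ k, increDecay (if k = j then h else 1) (y k)) ≤
      ENNReal.ofReal (K * h ^ (1 + max H (1 / 2))) := by
  obtain ⟨i, hi⟩ : ∃ i, i ≠ j := by
    by_contra! hall
    have : (Finset.univ : Finset ι) = {j} := by
      ext i
      simp [hall i]
    rw [this, Finset.sum_singleton, hj] at hsum
    norm_num at hsum
  -- The lower bound 1/2 keeps the share 1 - τ of coordinate i small enough for 2 α_i (1 - τ) < 1.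
  set τ : ℝ := max H (1 / 2) with hτ
  have hτ1 : τ < 1 := max_lt hH (by norm_num)
  have hτ2 : 1 / 2 ≤ τ := le_max_right _ _
  let θ : ι → ℝ := Pi.single j τ + Pi.single i (1 - τ)
  have hθj : θ j = τ := by simp [θ, hi.symm]
  have hθi : θ i = 1 - τ := by simp [θ, hi]
  have hθ0 : ∀ k, k ≠ i → k ≠ j → θ k = 0 := fun k h1 h2 => by simp [θ, h1, h2]
  have hθ : ∀ k, 0 ≤ θ k := fun k => by
    by_cases h1 : k = i
    · subst h1
      linarith
    · by_cases h2 : k = j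
      · subst h2
        linarith
      · rw [hθ0 k h1 h2]
  have hθα : ∀ k, 2 * α k * θ k < 1 := fun k => by
    by_cases h1 : k = i
    · subst h1
      rw [hθi]
      nlinarith [hα k, hα' k]
    · by_cases h2 : k = j
      · subst h2
        rw [hθj, hj]
        linarith
      · rw [hθ0 k h1 h2, mul_zero]
        exact one_pos
  refine ⟨C * ∏ k, decayConst (2 * α k * θ k), mul_nonneg hC (Finset.prod_nonneg fun k _ =>
    decayConst_nonneg (by have := hα k; have := hθ k; positivity) (hθα k)), fun h hh => ?_⟩
  refine (lintegral_weight_le (θ := θ) hw hC hwC hα hθ (by simp [θ, Finset.sum_add_distrib]) hθα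
    (ite_one_nonneg hh.1)).trans (le_of_eq ?_)
  rw [prod_mul_ite_rpow _ (Finset.mem_univ j), ← mul_assoc, hθj, hj]
  norm_num

/-- The increment factor in direction j is bounded by h² outright. What remains has no decay factor
in y_j, but it is integrable there by the weight alone since 2 α_j > 1. -/
lemma exists_bound_of_half_lt (hwm : Measurable w) (hw : ∀ y, 0 ≤ w y) (hC : 0 ≤ C)
    (hwC : ∀ y k, y k ≠ 0 → w y ≤ C * |y k| ^ (-(2 * α k))) (hα : ∀ k, 0 < α k)
    (hsum : 2 < ∑ k, 1 / α k) {j : ι} (hj : 1 / 2 < α j) :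
    ∃ K, ∀ h ∈ Set.Icc (0 : ℝ) 1,
      ∫⁻ y, ENNReal.ofReal (w y * ∏ k, increDecay (if k = j then h else 1) (y k)) ≤
      ENNReal.ofReal (K * h ^ 2) := by
  set r : ℝ := 2 - 1 / α j with hr
  have hr0 : 0 < r := by
    have h1 : 1 / α j < 2 := by
      rw [div_lt_iff₀ (hα j)]
      linarith
    linarith
  set S : ℝ := ∑ k ∈ Finset.univ.erase j, 1 / α k with hS
  have hSr : r < S := by
    rw [← Finset.add_sum_erase _ _ (Finset.mem_univ j)] at hsum
    linarith
  have hS0 : 0 < S := hr0.trans hSr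
  -- Weights proportional to 1/α_k give every remaining coordinate the same singularity r / S, and r
  -- < S says exactly that the sum of all 1/α_k exceeds 2.
  let θ : ι → ℝ := fun k => if k = j then 0 else 1 / α k / S
  have hθ : ∀ k, 0 ≤ θ k := fun k => by
    have := hα k
    simp only [θ]
    split_ifs <;> positivity
  have hθsum : ∑ k, θ k = 1 := by
    rw [← Finset.add_sum_erase _ _ (Finset.mem_univ j)]
    have : ∑ k ∈ Finset.univ.erase j, θ k = ∑ k ∈ Finset.univ.erase j, 1 / α k / S :=
      Finset.sum_congr rfl fun k hk => by simp [θ, Finset.ne_of_mem_erase hk]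
    rw [this, ← Finset.sum_div, ← hS, div_self hS0.ne']
    simp [θ]
  have hθα : ∀ k, r * α k * θ k < 1 := fun k => by
    by_cases hk : k = j
    · simp [θ, hk]
    · have h1 := (hα k).ne'
      have : r * α k * θ k = r / S := by
        simp only [θ, hk, if_false]
        field_simp
      rw [this]
      exact (div_lt_one hS0).2 hSr
  refine ⟨C * tailConst (α j) * ∏ k ∈ Finset.univ.erase j, decayConst (r * α k * θ k),
    fun h hh => ?_⟩
  calc ∫⁻ y, ENNReal.ofReal (w y * ∏ k, increDecay (if k = j then h else 1) (y k))
      ≤ ∫⁻ y, ENNReal.ofReal (h ^ 2) *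
          ENNReal.ofReal (w y * ∏ k ∈ Finset.univ.erase j, increDecay 1 (y k)) := by
        refine lintegral_mono fun y => ?_
        rw [← ENNReal.ofReal_mul (by positivity)]
        refine ENNReal.ofReal_le_ofReal ?_
        rw [← Finset.mul_prod_erase _ _ (Finset.mem_univ j), mul_left_comm, if_pos rfl]
        have : ∏ k ∈ Finset.univ.erase j, increDecay (if k = j then h else 1) (y k) =
            ∏ k ∈ Finset.univ.erase j, increDecay 1 (y k) :=
          Finset.prod_congr rfl fun k hk => by rw [if_neg (Finset.ne_of_mem_erase hk)]
        rw [this]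
        exact mul_le_mul_of_nonneg_right (min_le_left _ _) (mul_nonneg (hw y)
          (Finset.prod_nonneg fun k _ => increDecay_nonneg _ _))
    _ = ENNReal.ofReal (h ^ 2) * ∫⁻ y,
          ENNReal.ofReal (w y * ∏ k ∈ Finset.univ.erase j, increDecay 1 (y k)) :=
        lintegral_const_mul' _ _ ENNReal.ofReal_ne_top
    _ ≤ ENNReal.ofReal (h ^ 2) * ENNReal.ofReal
          (C * tailConst (α j) * ∏ k ∈ Finset.univ.erase j, decayConst (r * α k * θ k)) := by
        refine mul_le_mul_right ((lintegral_weight_erase_le (θ := θ) (h := fun _ => 1) hwm hw hC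
          hwC hα hθ hθsum (by simp [θ]) hj hθα fun _ => zero_le_one).trans (le_of_eq ?_)) _
        simp [hr]
    _ = _ := by
        rw [← ENNReal.ofReal_mul (by positivity), mul_comm]

end SpectralIntegral

/-! ### The threshold γ₀ and the spectral bound -/

section Regime

variable {d : ℕ} {α α' : Fin d → ℝ}

lemma two_lt_sum_inv (hd : 1 ≤ d) (hα : ∀ k, α k ∈ Set.Ioo (0 : ℝ) 1)
    (hα_one : d = 1 → ∀ k, α k < 1 / 2) : 2 < ∑ k, 1 / α k := by
  have h1 : ∀ k, 1 < 1 / α k := fun k => (one_lt_div (hα k).1).2 (hα k).2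
  rcases hd.eq_or_lt with rfl | hd
  · rw [Fin.sum_univ_one, lt_div_iff₀ (hα 0).1]
    linarith [hα_one rfl 0]
  · calc (2 : ℝ) ≤ ∑ _k : Fin d, (1 : ℝ) := by simpa using (by exact_mod_cast hd : (2 : ℝ) ≤ d)
      _ < ∑ k, 1 / α k := Finset.sum_lt_sum_of_nonempty ⟨⟨0, by omega⟩, Finset.mem_univ _⟩
          fun k _ => h1 k

/-- The infimum is over a finite set, so it is attained once that set is nonempty. A member is the
smallest ratio whose cumulative sum of 1/α_k exceeds 2. -/
lemma gammaZero_mem (hsum : 2 < ∑ k, 1 / α k) :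
    gammaZero α α' ∈ {γ : ℝ | γ ∈ Set.range (ratio α α') ∧
      2 < ∑ k with ratio α α' k ≤ γ, 1 / α k ∧ ∑ k with ratio α α' k < γ, 1 / α k ≤ 2} := by
  refine Set.Nonempty.csInf_mem ?_ ((Set.finite_range (ratio α α')).subset fun γ hγ => hγ.1)
  have hne : (Finset.univ : Finset (Fin d)).Nonempty := by
    by_contra h
    rw [Finset.not_nonempty_iff_eq_empty] at h
    rw [h, Finset.sum_empty] at hsum
    norm_num at hsum
  let T : Finset (Fin d) := {i | 2 < ∑ k with ratio α α' k ≤ ratio α α' i, 1 / α k}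
  have hT : T.Nonempty := by
    obtain ⟨i, -, hi⟩ := Finset.exists_max_image Finset.univ (ratio α α') hne
    refine ⟨i, Finset.mem_filter.2 ⟨Finset.mem_univ i, ?_⟩⟩
    rwa [Finset.filter_true_of_mem hi]
  obtain ⟨i, hiT, hi⟩ := Finset.exists_min_image T (ratio α α') hT
  refine ⟨ratio α α' i, ⟨i, rfl⟩, (Finset.mem_filter.1 hiT).2, ?_⟩
  rcases Finset.eq_empty_or_nonempty (Finset.univ.filter fun k => ratio α α' k < ratio α α' i)
    with h | h
  · rw [h, Finset.sum_empty]
    norm_num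
  · obtain ⟨l, hl, hmax⟩ := Finset.exists_max_image _ (ratio α α') h
    have hli : ratio α α' l < ratio α α' i := (Finset.mem_filter.1 hl).2
    -- The next smaller ratio has cumulative sum at most 2, and this sum is the strict sum at i.
    have hlT : l ∉ T := fun hlT => (hi l hlT).not_gt hli
    have heq : (Finset.univ.filter fun k => ratio α α' k < ratio α α' i) =
        Finset.univ.filter fun k => ratio α α' k ≤ ratio α α' l := by
      ext k
      simp only [Finset.mem_filter, Finset.mem_univ, true_and]
      exact ⟨fun hk => hmax k (by simpa using hk), fun hk => hk.trans_lt hli⟩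
    rw [heq]
    simpa [T] using hlT

lemma two_lt_sum_Ige (hsum : 2 < ∑ k, 1 / α k) :
    2 < ∑ k ∈ Ige α α', 1 / α k := by
  have h := (gammaZero_mem (α' := α') hsum).2.1
  convert h using 2
  ext k
  simp [Ige, Ieq, Igt, le_iff_eq_or_lt, eq_comm]

lemma Ieq_nonempty (hsum : 2 < ∑ k, 1 / α k) : (Ieq α α').Nonempty := by
  obtain ⟨k, hk⟩ := (gammaZero_mem (α' := α') hsum).1
  exact ⟨k, by simp [Ieq, hk]⟩

lemma disjoint_Ieq_Igt : Disjoint (Ieq α α') (Igt α α') := by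
  refine Finset.disjoint_left.2 fun k h1 h2 => ?_
  simp only [Ieq, Igt, Finset.mem_filter, Finset.mem_univ, true_and] at h1 h2
  exact absurd h1 (ne_of_gt h2)

/-- Each 1/α_k exceeds 1, so two directions would already contribute more than 2. Hence the cases of
`IsAdmissible` cover every j in I_=. -/
lemma card_Igt_le_one (hα : ∀ k, α k ∈ Set.Ioo (0 : ℝ) 1) (hq : qGt α α' < 2) :
    (Igt α α').card ≤ 1 := by
  by_contra! h
  have h1 : ∀ k, 1 ≤ 1 / α k := fun k => ((one_lt_div (hα k).1).2 (hα k).2).le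
  have h2 : ((Igt α α').card : ℝ) ≤ qGt α α' := by
    rw [qGt, ← nsmul_one, ← Finset.sum_const]
    exact Finset.sum_le_sum fun k _ => h1 k
  have h3 : (2 : ℝ) ≤ (Igt α α').card := by exact_mod_cast h
  linarith

lemma prod_extendZero {I J : Finset (Fin d)} (hJ : J ⊆ I) {M : Type*} [CommMonoid M]
    (F : Fin d → ℝ → M) (y : I → ℝ) :
    ∏ k ∈ J, F k (extendZero I y k) = ∏ k : I with k.1 ∈ J, F k (y k) := by
  symm
  refine Finset.prod_bij (fun k _ => k.1) (fun k hk => by simpa using hk)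
    (fun a _ b _ h => Subtype.ext h) (fun k hk => ⟨⟨k, hJ hk⟩, by simpa using hk, rfl⟩)
    fun k _ => ?_
  simp [extendZero]

@[fun_prop]
lemma continuous_extendZero (I : Finset (Fin d)) : Continuous (extendZero I) := by
  refine (PiLp.continuous_toLp 2 _).comp (continuous_pi fun k => ?_)
  by_cases hk : k ∈ I
  · simp only [hk, dif_pos]
    fun_prop
  · simp only [hk, dif_neg, not_false_eq_true]
    fun_prop

/-- The integral that controls the increments in a direction `j ∈ I_=`. -/
lemma exists_spectral_bound (hα : ∀ k, α k ∈ Set.Ioo (0 : ℝ) 1) (hsum : 2 < ∑ k, 1 / α k)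
    (hq : qGt α α' < 2) {L : EuclideanSpace ℝ (Fin d) → ℂ} (hL : Continuous L) {c : ℝ}
    (hc : 0 < c)
    (hLc : ∀ (y : EuclideanSpace ℝ (Fin d)) (k : Fin d), c * |y k| ^ α k ≤ ‖L y‖)
    {H : Fin d → ℝ} (hH : IsAdmissible α α' H) {j : Fin d} (hj : j ∈ Ieq α α') :
    ∃ K, 0 ≤ K ∧ ∀ h ∈ Set.Icc (0 : ℝ) 1,
      ∫⁻ y : Ige α α' → ℝ, ENNReal.ofReal (‖L (extendZero _ y)‖ ^ (-2 : ℤ) *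
        ∏ k ∈ Ieq α α', increDecay (if k = j then h else 1) (extendZero _ y k)) ≤
      ENNReal.ofReal (K * h ^ (2 * H j)) := by
  have hsub : Ieq α α' ⊆ Ige α α' := Finset.subset_union_left
  suffices hs : ∃ K, ∀ h ∈ Set.Icc (0 : ℝ) 1,
      ∫⁻ y : Ige α α' → ℝ, ENNReal.ofReal (‖L (extendZero _ y)‖ ^ (-2 : ℤ) *
        ∏ k : Ige α α' with k.1 ∈ Ieq α α',
          increDecay (if k = (⟨j, hsub hj⟩ : Ige α α') then h else 1) (y k)) ≤
      ENNReal.ofReal (K * h ^ (2 * H j)) by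
    obtain ⟨K, hK⟩ := hs
    refine ⟨max K 0, le_max_right _ _, fun h hh => ?_⟩
    have hF : ∀ y : Ige α α' → ℝ,
        ∏ k ∈ Ieq α α', increDecay (if k = j then h else 1) (extendZero _ y k) =
        ∏ k : Ige α α' with k.1 ∈ Ieq α α',
          increDecay (if k = (⟨j, hsub hj⟩ : Ige α α') then h else 1) (y k) := fun y => by
      rw [prod_extendZero hsub (fun k => increDecay (if k = j then h else 1))]
      simp only [Subtype.ext_iff]
    simp_rw [hF]
    exact (hK h hh).trans (ENNReal.ofReal_le_ofReal
      (mul_le_mul_of_nonneg_right (le_max_left _ _) (Real.rpow_nonneg hh.1 _)))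
  set w : (Ige α α' → ℝ) → ℝ := fun y => ‖L (extendZero _ y)‖ ^ (-2 : ℤ) with hw
  have hwm : Measurable w :=
    ((hL.comp (continuous_extendZero _)).norm.measurable).pow_const _
  have hw0 : ∀ y, 0 ≤ w y := fun y => by positivity
  have hC : 0 ≤ c ^ (-2 : ℤ) := by positivity
  have hwC : ∀ (y : Ige α α' → ℝ) (k : Ige α α'), y k ≠ 0 →
      w y ≤ c ^ (-2 : ℤ) * |y k| ^ (-(2 * α k)) := by
    intro y k hk
    have h1 : c * |y k| ^ α k ≤ ‖L (extendZero _ y)‖ := by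
      simpa [extendZero] using hLc (extendZero _ y) k
    have h2 : 0 < |y k| ^ α k := by positivity
    have h3 : |y k| ^ (-(2 * α k)) = (|y k| ^ α k) ^ (-2 : ℤ) := by
      rw [← Real.rpow_intCast, ← Real.rpow_mul (abs_nonneg _)]
      congr 1
      push_cast
      ring
    rw [h3, ← mul_zpow, hw]
    simp only [zpow_neg]
    exact inv_anti₀ (by positivity) (by
      simpa using pow_le_pow_left₀ (by positivity) h1 2)
  have hα0 : ∀ k : Ige α α', 0 < α k := fun k => (hα k).1
  have hα1 : ∀ k : Ige α α', α k < 1 := fun k => (hα k).2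
  rcases Nat.le_one_iff_eq_zero_or_eq_one.1 (card_Igt_le_one hα hq) with h0 | h1
  · have hempty : Igt α α' = ∅ := Finset.card_eq_zero.1 h0
    have huniv : (Finset.univ.filter fun k : Ige α α' => k.1 ∈ Ieq α α') = Finset.univ := by
      refine Finset.filter_true_of_mem fun k _ => ?_
      have : k.1 ∈ Ieq α α' ∪ Igt α α' := k.2
      rwa [hempty, Finset.union_empty] at this
    have hsum' : 2 < ∑ k : Ige α α', 1 / α k := by
      rw [Finset.sum_coe_sort (Ige α α') fun k => 1 / α k]
      exact two_lt_sum_Ige hsum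
    rw [huniv]
    rcases lt_trichotomy (α j) (1 / 2) with hlt | heq | hgt
    · obtain ⟨K, hK⟩ := exists_bound_of_lt_half (α := fun k : Ige α α' => α k) hw0 hC hwC hα0
        (j := ⟨j, hsub hj⟩) hlt
      refine ⟨K, fun h hh => (hK h hh).trans (le_of_eq ?_)⟩
      rw [hH.case_a j hj (Or.inr ⟨hempty, hlt⟩), qGt, hempty, Finset.sum_empty]
      congr 3
      ring
    · have hHj := hH.case_b j hj hempty heq
      obtain ⟨K, hK0, hK⟩ := exists_bound_of_eq_half (α := fun k : Ige α α' => α k) hw0 hC hwC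
        hα0 hα1 hsum' (j := ⟨j, hsub hj⟩) heq hHj.2
      refine ⟨K, fun h hh => (hK h hh).trans (ENNReal.ofReal_le_ofReal
        (mul_le_mul_of_nonneg_left ?_ hK0))⟩
      -- For h ≤ 1 a larger exponent is stronger, and 1 + max(H_j, 1/2) ≥ 2 H_j because H_j < 1.
      refine Real.rpow_le_rpow_of_exponent_ge' hh.1 hh.2 (by linarith [hHj.1]) ?_
      linarith [le_max_left (H j) (1 / 2), hHj.2]
    · obtain ⟨K, hK⟩ := exists_bound_of_half_lt (α := fun k : Ige α α' => α k) hwm hw0 hC hwC hα0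
        hsum' (j := ⟨j, hsub hj⟩) hgt
      refine ⟨K, fun h hh => (hK h hh).trans (le_of_eq ?_)⟩
      rw [hH.case_c j hj hempty hgt]
      norm_num
  · obtain ⟨m, hm⟩ := Finset.card_eq_one.1 h1
    have hmI : m ∈ Ige α α' := Finset.mem_union_right _ (by simp [hm])
    have hjm : j ≠ m := fun h =>
      Finset.disjoint_left.1 disjoint_Ieq_Igt hj (by simp [hm, h])
    have herase : (Finset.univ.filter fun k : Ige α α' => k.1 ∈ Ieq α α') =
        Finset.univ.erase ⟨m, hmI⟩ := by
      ext k
      have hk : k.1 ∈ Ieq α α' ∪ Igt α α' := k.2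
      simp only [Finset.mem_filter, Finset.mem_univ, true_and, Finset.mem_erase, and_true, ne_eq,
        Subtype.ext_iff]
      constructor
      · intro hkE hkm
        exact Finset.disjoint_left.1 disjoint_Ieq_Igt hkE (by simp [hm, hkm])
      · intro hkm
        rw [Finset.mem_union, hm, Finset.mem_singleton] at hk
        exact hk.resolve_right hkm
    have hqm : qGt α α' = 1 / α m := by rw [qGt, hm, Finset.sum_singleton]
    -- With a single direction in I_>, the assumption q(π_> E) < 2 is precisely integrability at
    -- infinity in that direction.
    have hαm : 1 / 2 < α m := by
      rw [hqm, div_lt_iff₀ (hα m).1] at hq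
      linarith
    rw [herase]
    obtain ⟨K, hK⟩ := exists_bound_of_compl_eq_singleton (α := fun k : Ige α α' => α k) hwm hw0 hC
      hwC hα0 hα1 (m := ⟨m, hmI⟩) hαm (j := ⟨j, hsub hj⟩) (by simpa [Subtype.ext_iff] using hjm)
    refine ⟨K, fun h hh => (hK h hh).trans (le_of_eq ?_)⟩
    rw [hH.case_a j hj (Or.inl h1), hqm]
    congr 3
    ring

end Regime

/-! ### Spectral factors and the covariance under a change of one coordinate -/

/-- The factor `(e^{i t y} - 1) / (√(2π) |y|)` of `spectralFactor`. -/
def spectralRoot (t y : ℝ) : ℂ :=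
  (Complex.exp (Complex.I * t * y) - 1) / (Real.sqrt (2 * Real.pi) * |y| : ℝ)

/-- This Gram form, a function of t times the conjugate of the same function of s, is what turns
second differences into squared norms. -/
lemma spectralFactor_eq (t s y : ℝ) :
    spectralFactor t s y = spectralRoot t y * (starRingEnd ℂ) (spectralRoot s y) := by
  have h : (2 * Real.pi * |y| ^ 2 : ℝ) =
      (Real.sqrt (2 * Real.pi) * |y|) * (Real.sqrt (2 * Real.pi) * |y|) := by
    rw [mul_mul_mul_comm, Real.mul_self_sqrt (by positivity), sq]
  rw [spectralFactor, spectralRoot, spectralRoot, map_div₀, Complex.conj_ofReal,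
    div_mul_div_comm, h, Complex.ofReal_mul (Real.sqrt (2 * Real.pi) * |y|)]

/-- The numerator is at most |t - s| |y| by the Lipschitz bound for e^{ix} and at most 2 trivially;
the factor 2π is discarded. At y = 0 both sides are 0 by the conventions for division and powers. -/
lemma norm_spectralRoot_sub_sq_le (t s y : ℝ) :
    ‖spectralRoot t y - spectralRoot s y‖ ^ 2 ≤ increDecay |t - s| y := by
  rcases eq_or_ne y 0 with rfl | hy
  · simpa [spectralRoot, increDecay] using sq_nonneg (t - s)
  have hpi : 1 ≤ 2 * Real.pi := by linarith [Real.pi_gt_three]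
  have hy' : 0 < |y| := abs_pos.2 hy
  set e : ℂ := Complex.exp (Complex.I * t * y) - Complex.exp (Complex.I * s * y) with he
  have h1 : ‖e‖ ≤ |t - s| * |y| := by
    have : e = Complex.exp (Complex.I * s * y) *
        (Complex.exp (Complex.I * ((t - s) * y : ℝ)) - 1) := by
      rw [he, mul_sub, ← Complex.exp_add, mul_one]
      congr 2
      push_cast
      ring
    rw [this, norm_mul, show Complex.I * (s : ℂ) * y = ((s * y : ℝ) : ℂ) * Complex.I by
      push_cast; ring, Complex.norm_exp_ofReal_mul_I, one_mul, ← abs_mul]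
    exact Real.norm_exp_I_mul_ofReal_sub_one_le
  have h2 : ‖e‖ ≤ 2 := by
    have hn : ∀ a : ℝ, ‖Complex.exp (Complex.I * a * y)‖ = 1 := fun a => by
      rw [show Complex.I * (a : ℂ) * y = ((a * y : ℝ) : ℂ) * Complex.I by push_cast; ring,
        Complex.norm_exp_ofReal_mul_I]
    refine (norm_sub_le _ _).trans ?_
    rw [hn, hn]
    norm_num
  have h3 : ‖spectralRoot t y - spectralRoot s y‖ ^ 2 = ‖e‖ ^ 2 / (2 * Real.pi * |y| ^ 2) := by
    rw [spectralRoot, spectralRoot, ← sub_div, sub_sub_sub_cancel_right, ← he, norm_div, div_pow,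
      Complex.norm_real, Real.norm_eq_abs, sq_abs, mul_pow, Real.sq_sqrt (by positivity)]
  have h4 : ‖e‖ ^ 2 / (2 * Real.pi * |y| ^ 2) ≤ ‖e‖ ^ 2 / |y| ^ 2 :=
    div_le_div_of_nonneg_left (by positivity) (by positivity) (le_mul_of_one_le_left (by positivity)
      hpi)
  rw [h3]
  refine h4.trans (le_min ?_ ?_)
  · rw [div_le_iff₀ (by positivity), ← mul_pow]
    exact pow_le_pow_left₀ (norm_nonneg _) h1 2
  · rw [Real.rpow_neg hy'.le, Real.rpow_two, ← div_eq_mul_inv]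
    gcongr
    nlinarith [norm_nonneg e]

lemma increDecay_mono {h h' : ℝ} (hh : 0 ≤ h) (hle : h ≤ h') (y : ℝ) :
    increDecay h y ≤ increDecay h' y :=
  min_le_min (pow_le_pow_left₀ hh hle 2) le_rfl

lemma norm_spectralRoot_sq_le {t : ℝ} (ht : t ∈ Set.Icc (0 : ℝ) 1) (y : ℝ) :
    ‖spectralRoot t y‖ ^ 2 ≤ increDecay 1 y := by
  have := norm_spectralRoot_sub_sq_le t 0 y
  simp only [spectralRoot, Complex.ofReal_zero, mul_zero, zero_mul, Complex.exp_zero, sub_self,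
    zero_div, sub_zero] at this
  exact this.trans (increDecay_mono (abs_nonneg _) (by rw [abs_of_nonneg ht.1]; exact ht.2) y)

@[fun_prop]
lemma measurable_spectralRoot (t : ℝ) : Measurable (spectralRoot t) := by
  unfold spectralRoot
  fun_prop

section Variance

variable {d : ℕ}

/-- When t and s differ in coordinate j only, a product that does not involve j is the same for all
four pairs in a second difference and can be factored out. -/
lemma prod_eq_of_notMem {M : Type*} [CommMonoid M] {J : Finset (Fin d)} {j : Fin d} (hj : j ∉ J)
    (f : Fin d → ℝ → ℝ → M) {t s a b : Fin d → ℝ} (hts : ∀ k, k ≠ j → t k = s k)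
    (ha : a = t ∨ a = s) (hb : b = t ∨ b = s) :
    ∏ k ∈ J, f k (a k) (b k) = ∏ k ∈ J, f k (t k) (t k) := by
  refine Finset.prod_congr rfl fun k hk => ?_
  have hk' := hts k fun h => hj (h ▸ hk)
  rcases ha with rfl | rfl <;> rcases hb with rfl | rfl <;> simp [hk']

lemma prod_eq_of_mem {M : Type*} [CommMonoid M] {J : Finset (Fin d)} {j : Fin d} (hj : j ∈ J)
    (f : Fin d → ℝ → ℝ → M) {t s a b : Fin d → ℝ} (hts : ∀ k, k ≠ j → t k = s k)
    (ha : a = t ∨ a = s) (hb : b = t ∨ b = s) :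
    ∏ k ∈ J, f k (a k) (b k) = f j (a j) (b j) * ∏ k ∈ J.erase j, f k (t k) (t k) := by
  rw [← Finset.mul_prod_erase _ _ hj, prod_eq_of_notMem (Finset.notMem_erase j J) f hts ha hb]

lemma abs_prod_le_one {J : Finset (Fin d)} {f : Fin d → ℝ} (h : ∀ k, |f k| ≤ 1) :
    |∏ k ∈ J, f k| ≤ 1 := by
  rw [Finset.abs_prod]
  exact Finset.prod_le_one (fun k _ => abs_nonneg _) fun k _ => h k

lemma fbmCov_half_self (t : ℝ) : fbmCov (1 / 2) t t = |t| := by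
  simp [fbmCov]

/-- The spectral integral of `limitCov`. -/
def spectralIntegral (L : EuclideanSpace ℝ (Fin d) → ℂ) (α α' t s : Fin d → ℝ) : ℂ :=
  ∫ y : Ige α α' → ℝ, ((‖L (extendZero _ y)‖ ^ (-2 : ℤ) : ℝ) : ℂ) *
    ∏ k ∈ Ieq α α', spectralFactor (t k) (s k) (extendZero _ y k)

lemma limitCov_eq {μ : Measure (Site d)} {p : ℝ} {ν : Measure (EuclideanSpace ℝ (Fin d))}
    {α α' : Fin d → ℝ} (t s : EuclideanSpace ℝ (Fin d)) :
    limitCov μ p ν α α' t s = (sigmaSq μ p : ℂ) *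
      (∏ k ∈ Ilt α α', fbmCov (1 / 2) (t k) (s k) : ℝ) *
      (∏ k ∈ Igt α α', t k * s k / (2 * Real.pi) : ℝ) *
      spectralIntegral (logCharFun ν) α α' t s := rfl

variable {α α' : Fin d → ℝ} {L : EuclideanSpace ℝ (Fin d) → ℂ}

lemma norm_prod_spectralRoot_sq_le (y : EuclideanSpace ℝ (Fin d)) {t : Fin d → ℝ}
    (ht : ∀ k, t k ∈ Set.Icc (0 : ℝ) 1) (J : Finset (Fin d)) :
    ‖∏ k ∈ J, spectralRoot (t k) (y k)‖ ^ 2 ≤ ∏ k ∈ J, increDecay 1 (y k) := by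
  rw [norm_prod, ← Finset.prod_pow]
  exact Finset.prod_le_prod (fun k _ => by positivity) fun k _ =>
    norm_spectralRoot_sq_le (ht k) (y k)

lemma norm_spectral_integrand_le (y : EuclideanSpace ℝ (Fin d)) {t s : Fin d → ℝ}
    (ht : ∀ k, t k ∈ Set.Icc (0 : ℝ) 1) (hs : ∀ k, s k ∈ Set.Icc (0 : ℝ) 1) :
    ‖((‖L y‖ ^ (-2 : ℤ) : ℝ) : ℂ) * ∏ k ∈ Ieq α α', spectralFactor (t k) (s k) (y k)‖ ≤
      ‖L y‖ ^ (-2 : ℤ) * ∏ k ∈ Ieq α α', increDecay 1 (y k) := by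
  rw [norm_mul, Complex.norm_real, Real.norm_of_nonneg (by positivity)]
  refine mul_le_mul_of_nonneg_left ?_ (by positivity)
  simp_rw [spectralFactor_eq]
  rw [Finset.prod_mul_distrib, ← map_prod, norm_mul, RCLike.norm_conj]
  have h1 := norm_prod_spectralRoot_sq_le y ht (Ieq α α')
  have h2 := norm_prod_spectralRoot_sq_le y hs (Ieq α α')
  nlinarith [sq_nonneg (‖∏ k ∈ Ieq α α', spectralRoot (t k) (y k)‖ -
    ‖∏ k ∈ Ieq α α', spectralRoot (s k) (y k)‖)]

lemma measurable_spectral_integrand (hL : Continuous L) (t s : Fin d → ℝ) :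
    Measurable fun y : Ige α α' → ℝ => ((‖L (extendZero _ y)‖ ^ (-2 : ℤ) : ℝ) : ℂ) *
      ∏ k ∈ Ieq α α', spectralFactor (t k) (s k) (extendZero _ y k) := by
  have h1 : Measurable fun y : Ige α α' → ℝ => ‖L (extendZero _ y)‖ ^ (-2 : ℤ) :=
    ((hL.comp (continuous_extendZero _)).norm.measurable).pow_const _
  have h2 : ∀ k, Measurable fun y : Ige α α' → ℝ => extendZero (Ige α α') y k := fun k =>
    (((continuous_apply k).comp (PiLp.continuous_ofLp 2 _)).comp
      (continuous_extendZero _)).measurable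
  refine (Complex.measurable_ofReal.comp h1).mul (Finset.measurable_prod _ fun k _ => ?_)
  simp_rw [spectralFactor_eq]
  exact ((measurable_spectralRoot _).comp (h2 k)).mul
    (Complex.continuous_conj.measurable.comp ((measurable_spectralRoot _).comp (h2 k)))

lemma norm_integral_le_of_lintegral_le {X : Type*} [MeasurableSpace X] {m : Measure X} {f : X → ℂ}
    {g : X → ℝ} {K : ℝ} (hK : 0 ≤ K) (hfg : ∀ x, ‖f x‖ ≤ g x)
    (hg : ∫⁻ x, ENNReal.ofReal (g x) ∂m ≤ ENNReal.ofReal K) : ‖∫ x, f x ∂m‖ ≤ K := by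
  refine (norm_integral_le_lintegral_norm f).trans ?_
  refine (ENNReal.toReal_mono ENNReal.ofReal_ne_top
    ((lintegral_mono fun x => ENNReal.ofReal_le_ofReal (hfg x)).trans hg)).trans ?_
  rw [ENNReal.toReal_ofReal hK]

lemma integrable_spectral_integrand (hL : Continuous L) {K : ℝ}
    (hK : ∫⁻ y : Ige α α' → ℝ, ENNReal.ofReal (‖L (extendZero _ y)‖ ^ (-2 : ℤ) *
      ∏ k ∈ Ieq α α', increDecay 1 (extendZero _ y k)) ≤ ENNReal.ofReal K)
    {t s : Fin d → ℝ} (ht : ∀ k, t k ∈ Set.Icc (0 : ℝ) 1) (hs : ∀ k, s k ∈ Set.Icc (0 : ℝ) 1) :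
    Integrable fun y : Ige α α' → ℝ => ((‖L (extendZero _ y)‖ ^ (-2 : ℤ) : ℝ) : ℂ) *
      ∏ k ∈ Ieq α α', spectralFactor (t k) (s k) (extendZero _ y k) := by
  refine ⟨(measurable_spectral_integrand hL t s).aestronglyMeasurable, ?_⟩
  rw [hasFiniteIntegral_iff_norm]
  exact ((lintegral_mono fun y => ENNReal.ofReal_le_ofReal
    (norm_spectral_integrand_le _ ht hs)).trans hK).trans_lt ENNReal.ofReal_lt_top

lemma norm_spectralIntegral_le {K : ℝ} (hK0 : 0 ≤ K)
    (hK : ∫⁻ y : Ige α α' → ℝ, ENNReal.ofReal (‖L (extendZero _ y)‖ ^ (-2 : ℤ) *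
      ∏ k ∈ Ieq α α', increDecay 1 (extendZero _ y k)) ≤ ENNReal.ofReal K)
    {t s : Fin d → ℝ} (ht : ∀ k, t k ∈ Set.Icc (0 : ℝ) 1) (hs : ∀ k, s k ∈ Set.Icc (0 : ℝ) 1) :
    ‖spectralIntegral L α α' t s‖ ≤ K :=
  norm_integral_le_of_lintegral_le hK0 (fun _ => norm_spectral_integrand_le _ ht hs) hK

lemma integral_sub_sub_add {X : Type*} [MeasurableSpace X] {m : Measure X} {f₁ f₂ f₃ f₄ : X → ℂ}
    (h₁ : Integrable f₁ m) (h₂ : Integrable f₂ m) (h₃ : Integrable f₃ m) (h₄ : Integrable f₄ m) :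
    ∫ x, (f₁ x - f₂ x - f₃ x + f₄ x) ∂m =
      ∫ x, f₁ x ∂m - ∫ x, f₂ x ∂m - ∫ x, f₃ x ∂m + ∫ x, f₄ x ∂m := by
  have h := h₁.sub h₂
  change ∫ x, (f₁ - f₂ - f₃ + f₄) x ∂m = _
  rw [integral_add' (h.sub h₃) h₄, integral_sub' h h₃, integral_sub' h₁ h₂]

/-- By the Gram form the four integrands combine into |a - b|², where a and b differ only in their
factor for j. The other factors are bounded uniformly on the cube. -/
lemma norm_spectralIntegral_increment_le (hL : Continuous L) {K₁ K : ℝ} (hK0 : 0 ≤ K)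
    (hK₁ : ∫⁻ y : Ige α α' → ℝ, ENNReal.ofReal (‖L (extendZero _ y)‖ ^ (-2 : ℤ) *
      ∏ k ∈ Ieq α α', increDecay 1 (extendZero _ y k)) ≤ ENNReal.ofReal K₁)
    {t s : Fin d → ℝ} (ht : ∀ k, t k ∈ Set.Icc (0 : ℝ) 1) (hs : ∀ k, s k ∈ Set.Icc (0 : ℝ) 1)
    {j : Fin d} (hj : j ∈ Ieq α α') (hts : ∀ k, k ≠ j → t k = s k)
    (hK : ∫⁻ y : Ige α α' → ℝ, ENNReal.ofReal (‖L (extendZero _ y)‖ ^ (-2 : ℤ) *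
      ∏ k ∈ Ieq α α', increDecay (if k = j then |t j - s j| else 1) (extendZero _ y k)) ≤
        ENNReal.ofReal K) :
    ‖spectralIntegral L α α' t t - spectralIntegral L α α' t s - spectralIntegral L α α' s t +
      spectralIntegral L α α' s s‖ ≤ K := by
  have hi := fun a b ha hb => integrable_spectral_integrand (t := a) (s := b) hL hK₁ ha hb
  unfold spectralIntegral
  rw [← integral_sub_sub_add (hi t t ht ht) (hi t s ht hs) (hi s t hs ht) (hi s s hs hs)]
  refine norm_integral_le_of_lintegral_le hK0 (fun y => ?_) hK
  set z := extendZero (Ige α α') y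
  set Q : ℂ := ∏ k ∈ (Ieq α α').erase j, spectralRoot (t k) (z k) with hQ
  have hF : ∀ a : Fin d → ℝ, (a = t ∨ a = s) →
      ∏ k ∈ Ieq α α', spectralRoot (a k) (z k) = spectralRoot (a j) (z j) * Q := fun a ha =>
    prod_eq_of_mem hj (fun k u _ => spectralRoot u (z k)) (b := t) hts ha (Or.inl rfl)
  have hP : ∀ a b : Fin d → ℝ, (a = t ∨ a = s) → (b = t ∨ b = s) →
      ∏ k ∈ Ieq α α', spectralFactor (a k) (b k) (z k) =
        (spectralRoot (a j) (z j) * Q) * (starRingEnd ℂ) (spectralRoot (b j) (z j) * Q) := by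
    intro a b ha hb
    simp_rw [spectralFactor_eq]
    rw [Finset.prod_mul_distrib, ← map_prod, hF a ha, hF b hb]
  rw [hP t t (Or.inl rfl) (Or.inl rfl), hP t s (Or.inl rfl) (Or.inr rfl),
    hP s t (Or.inr rfl) (Or.inl rfl), hP s s (Or.inr rfl) (Or.inr rfl)]
  have hsq : ∀ (w : ℂ) (a b : ℂ), w * (a * (starRingEnd ℂ) a) - w * (a * (starRingEnd ℂ) b) -
      w * (b * (starRingEnd ℂ) a) + w * (b * (starRingEnd ℂ) b) =
      w * ((a - b) * (starRingEnd ℂ) (a - b)) := fun w a b => by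
    rw [map_sub]
    ring
  rw [hsq, ← sub_mul, norm_mul, Complex.norm_real, Real.norm_of_nonneg (by positivity)]
  refine mul_le_mul_of_nonneg_left ?_ (by positivity)
  rw [norm_mul, RCLike.norm_conj, ← sq, norm_mul, mul_pow, ← Finset.mul_prod_erase _ _ hj,
    if_pos rfl]
  refine mul_le_mul (norm_spectralRoot_sub_sq_le _ _ _) ?_ (by positivity) (increDecay_nonneg _ _)
  refine (norm_prod_spectralRoot_sq_le z ht _).trans (le_of_eq (Finset.prod_congr rfl fun k hk => ?_))
  rw [if_neg (Finset.ne_of_mem_erase hk)]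

/-- The exponents of the anisotropic distance `aniso`. -/
def anisoExp (α α' H : Fin d → ℝ) (j : Fin d) : ℝ :=
  if j ∈ Igt α α' then 1 else if j ∈ Ilt α α' then 1 / 2 else H j

lemma aniso_eq_sum (H : Fin d → ℝ) (s t : EuclideanSpace ℝ (Fin d)) :
    aniso α α' H s t = ∑ j, |t j - s j| ^ anisoExp α α' H j := by
  have hnot : ∀ j ∈ Ilt α α', j ∉ Igt α α' := fun j hj h => by
    simp only [Ilt, Igt, Finset.mem_filter, Finset.mem_univ, true_and] at hj h
    exact lt_asymm hj h
  have hnot' : ∀ j ∈ Ieq α α', j ∉ Igt α α' ∧ j ∉ Ilt α α' := fun j hj => by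
    simp only [Ieq, Ilt, Igt, Finset.mem_filter, Finset.mem_univ, true_and] at hj ⊢
    simp [hj]
  have h1 : ∑ j ∈ Igt α α', |t j - s j| =
      ∑ j ∈ Igt α α', |t j - s j| ^ anisoExp α α' H j :=
    Finset.sum_congr rfl fun j hj => by simp [anisoExp, hj]
  have h2 : ∑ j ∈ Ilt α α', |t j - s j| ^ (1 / 2 : ℝ) =
      ∑ j ∈ Ilt α α', |t j - s j| ^ anisoExp α α' H j :=
    Finset.sum_congr rfl fun j hj => by simp [anisoExp, hj, hnot j hj]
  have h3 : ∑ j ∈ Ieq α α', |t j - s j| ^ H j =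
      ∑ j ∈ Ieq α α', |t j - s j| ^ anisoExp α α' H j :=
    Finset.sum_congr rfl fun j hj => by simp [anisoExp, hnot' j hj]
  rw [aniso, h1, h2, h3, ← Finset.sum_union (Finset.disjoint_right.2 hnot),
    ← Finset.sum_union]
  · refine Finset.sum_congr ?_ fun _ _ => rfl
    ext j
    simp only [Ieq, Ilt, Igt, Finset.mem_union, Finset.mem_filter, Finset.mem_univ, true_and,
      iff_true]
    rcases lt_trichotomy (gammaZero α α') (ratio α α' j) with h | h | h <;> simp [h]
  · refine Finset.disjoint_right.2 fun j hj h => ?_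
    rcases Finset.mem_union.1 h with h | h
    exacts [(hnot' j hj).1 h, (hnot' j hj).2 h]

/-- Exponents in (0, 1] make the anisotropic distance satisfy the triangle inequality. In the
formula of case (a) with |I_>| = 1, positivity uses q < 2 and the upper bound uses q > 1. -/
lemma IsAdmissible.exp_mem (hα : ∀ k, α k ∈ Set.Ioo (0 : ℝ) 1) (hq : qGt α α' < 2)
    {H : Fin d → ℝ} (hH : IsAdmissible α α' H) {j : Fin d} (hj : j ∈ Ieq α α') :
    0 < H j ∧ H j ≤ 1 := by
  have h0 := (hα j).1
  have h1 := (hα j).2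
  rcases Nat.le_one_iff_eq_zero_or_eq_one.1 (card_Igt_le_one hα hq) with hc | hc
  · have hempty : Igt α α' = ∅ := Finset.card_eq_zero.1 hc
    rcases lt_trichotomy (α j) (1 / 2) with hlt | heq | hgt
    · rw [hH.case_a j hj (Or.inr ⟨hempty, hlt⟩), qGt, hempty, Finset.sum_empty]
      constructor <;> linarith
    · have := hH.case_b j hj hempty heq
      exact ⟨this.1, this.2.le⟩
    · rw [hH.case_c j hj hempty hgt]
      norm_num
  · rw [hH.case_a j hj (Or.inl hc)]
    obtain ⟨m, hm⟩ := Finset.card_eq_one.1 hc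
    have h2 : 1 < qGt α α' := by
      rw [qGt, hm, Finset.sum_singleton]
      exact (one_lt_div (hα m).1).2 (hα m).2
    constructor <;> nlinarith

lemma anisoExp_mem (hα : ∀ k, α k ∈ Set.Ioo (0 : ℝ) 1) (hq : qGt α α' < 2)
    {H : Fin d → ℝ} (hH : IsAdmissible α α' H) (j : Fin d) :
    0 < anisoExp α α' H j ∧ anisoExp α α' H j ≤ 1 := by
  unfold anisoExp
  split_ifs with h1 h2
  · norm_num
  · norm_num
  · refine hH.exp_mem hα hq ?_
    simp only [Ieq, Ilt, Igt, Finset.mem_filter, Finset.mem_univ, true_and] at h1 h2 ⊢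
    linarith

/-- The modification is chosen before H, and proving that it is one needs some admissible H. The
value 1/2 in the free case is arbitrary. -/
lemma exists_isAdmissible : ∃ H, IsAdmissible α α' H := by
  classical
  refine ⟨fun j => if (Igt α α').card = 1 ∨ (Igt α α' = ∅ ∧ α j < 1 / 2) then
    α j * (1 - qGt α α' / 2) + 1 / 2 else if α j = 1 / 2 then 1 / 2 else 1,
    fun j _ h => if_pos h, fun j _ h0 h => ?_, fun j _ h0 h => ?_⟩
  · have : ¬ ((Igt α α').card = 1 ∨ (Igt α α' = ∅ ∧ α j < 1 / 2)) := by simp [h0, h]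
    rw [if_neg this, if_pos h]
    norm_num
  · have : ¬ ((Igt α α').card = 1 ∨ (Igt α α' = ∅ ∧ α j < 1 / 2)) := by simp [h0]; linarith
    rw [if_neg this, if_neg h.ne']

end Variance

/-! ### Second moments of the increments -/

section Increments

variable {d : ℕ} {μ : Measure (Site d)} {p : ℝ} {ν : Measure (EuclideanSpace ℝ (Fin d))}
  {α α' : Fin d → ℝ} {Ω : Type*} [MeasurableSpace Ω] {P : Measure Ω}
  {W : EuclideanSpace ℝ (Fin d) → Ω → ℝ}

/-- The second moment of an increment in terms of the covariance function. -/
lemma IsLimitField.integral_sub_sq [IsProbabilityMeasure P] (hW : IsLimitField μ p ν α α' P W)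
    (t s : EuclideanSpace ℝ (Fin d)) :
    ((∫ ω, (W t ω - W s ω) ^ 2 ∂P : ℝ) : ℂ) = limitCov μ p ν α α' t t - limitCov μ p ν α α' t s -
      limitCov μ p ν α α' s t + limitCov μ p ν α α' s s := by
  have ht := (hW.gaussian.hasGaussianLaw_eval t).memLp_two
  have hs := (hW.gaussian.hasGaussianLaw_eval s).memLp_two
  have hmean : ∫ ω, (W t - W s) ω ∂P = 0 := by
    rw [integral_sub' (ht.integrable one_le_two) (hs.integrable one_le_two), hW.mean_zero,
      hW.mean_zero, sub_zero]
  have h1 : ∫ ω, (W t ω - W s ω) ^ 2 ∂P = cov[W t - W s, W t - W s; P] := by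
    rw [covariance_self (ht.sub hs).aestronglyMeasurable.aemeasurable,
      variance_of_integral_eq_zero (ht.sub hs).aestronglyMeasurable.aemeasurable hmean]
    rfl
  rw [h1, covariance_sub_sub ht hs ht hs]
  push_cast
  rw [hW.cov_eq, hW.cov_eq, hW.cov_eq, hW.cov_eq]

lemma norm_mul_le_of_le_one {σ a b K : ℝ} {z : ℂ} (ha : |a| ≤ 1) (hb : |b| ≤ 1) (hz : ‖z‖ ≤ K) :
    ‖(σ : ℂ) * (a : ℂ) * (b : ℂ) * z‖ ≤ |σ| * K := by
  rw [norm_mul, norm_mul, norm_mul, Complex.norm_real, Complex.norm_real, Complex.norm_real,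
    Real.norm_eq_abs, Real.norm_eq_abs, Real.norm_eq_abs]
  have h1 : |σ| * |a| * |b| ≤ |σ| := by
    calc |σ| * |a| * |b| ≤ |σ| * 1 * 1 := by gcongr
      _ = |σ| := by ring
  exact mul_le_mul h1 hz (norm_nonneg _) (abs_nonneg _)

lemma abs_fbmCov_half_le_one {t : ℝ} (ht : t ∈ Set.Icc (0 : ℝ) 1) : |fbmCov (1 / 2) t t| ≤ 1 := by
  rw [fbmCov_half_self, abs_abs, abs_of_nonneg ht.1]
  exact ht.2

lemma abs_mul_div_two_pi_le {a b c : ℝ} (h : |a * b| ≤ c) : |a * b / (2 * Real.pi)| ≤ c := by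
  rw [abs_div, abs_of_pos (show (0 : ℝ) < 2 * Real.pi by positivity)]
  exact (div_le_self (abs_nonneg _) (by linarith [Real.pi_gt_three])).trans h

lemma abs_mul_self_div_two_pi_le_one {t : ℝ} (ht : t ∈ Set.Icc (0 : ℝ) 1) :
    |t * t / (2 * Real.pi)| ≤ 1 := by
  refine abs_mul_div_two_pi_le ?_
  rw [abs_mul_self]
  nlinarith [ht.1, ht.2]

/-- Since the second moment is nonnegative, norm estimates for the complex covariance apply with no
discussion of its real part. -/
lemma IsLimitField.integral_sub_sq_eq_norm [IsProbabilityMeasure P]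
    (hW : IsLimitField μ p ν α α' P W)
    (t s : EuclideanSpace ℝ (Fin d)) :
    ∫ ω, (W t ω - W s ω) ^ 2 ∂P = ‖limitCov μ p ν α α' t t -
      limitCov μ p ν α α' t s - limitCov μ p ν α α' s t + limitCov μ p ν α α' s s‖ := by
  rw [← hW.integral_sub_sq, Complex.norm_real, Real.norm_of_nonneg]
  exact integral_nonneg fun ω => sq_nonneg _

lemma abs_prod_fbmCov_le_one {t : EuclideanSpace ℝ (Fin d)} (ht : t ∈ unitCube d)
    (J : Finset (Fin d)) : |∏ k ∈ J, fbmCov (1 / 2) (t k) (t k)| ≤ 1 :=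
  abs_prod_le_one fun k => abs_fbmCov_half_le_one (ht k)

lemma abs_prod_mul_self_le_one {t : EuclideanSpace ℝ (Fin d)} (ht : t ∈ unitCube d)
    (J : Finset (Fin d)) : |∏ k ∈ J, t k * t k / (2 * Real.pi)| ≤ 1 :=
  abs_prod_le_one fun k => abs_mul_self_div_two_pi_le_one (ht k)

/-- Only the Brownian factor of j changes, and its second difference is |t_j - s_j|, the square of
the distance with exponent 1/2. -/
lemma IsLimitField.increment_bound_Ilt [IsProbabilityMeasure P]
    (hW : IsLimitField μ p ν α α' P W) (H : Fin d → ℝ)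
    {K₁ : ℝ} (hK₁0 : 0 ≤ K₁)
    (hK₁ : ∫⁻ y : Ige α α' → ℝ, ENNReal.ofReal (‖logCharFun ν (extendZero _ y)‖ ^ (-2 : ℤ) *
      ∏ k ∈ Ieq α α', increDecay 1 (extendZero _ y k)) ≤ ENNReal.ofReal K₁)
    {j : Fin d} (hj : gammaZero α α' < ratio α α' j) :
    ∃ C, 0 ≤ C ∧ ∀ t ∈ unitCube d, ∀ s ∈ unitCube d, (∀ k, k ≠ j → t k = s k) →
      ∫ ω, (W t ω - W s ω) ^ 2 ∂P ≤ C * (|t j - s j| ^ anisoExp α α' H j) ^ 2 := by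
  have hlt : j ∈ Ilt α α' := by simp [Ilt, hj]
  have heq : j ∉ Ieq α α' := by simp [Ieq, hj.ne]
  have hgt : j ∉ Igt α α' := by simp [Igt, hj.le]
  refine ⟨|sigmaSq μ p| * K₁, by positivity, fun t ht s hs hts => ?_⟩
  have hcov : ∀ a b : EuclideanSpace ℝ (Fin d), (a = t ∨ a = s) → (b = t ∨ b = s) →
      limitCov μ p ν α α' a b = (sigmaSq μ p : ℂ) * ((fbmCov (1 / 2) (a j) (b j) *
        ∏ k ∈ (Ilt α α').erase j, fbmCov (1 / 2) (t k) (t k) : ℝ) : ℂ) *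
        (∏ k ∈ Igt α α', t k * t k / (2 * Real.pi) : ℝ) *
        spectralIntegral (logCharFun ν) α α' t t := by
    intro a b ha hb
    have ha' : a.ofLp = t.ofLp ∨ a.ofLp = s.ofLp := ha.imp (congrArg _) (congrArg _)
    have hb' : b.ofLp = t.ofLp ∨ b.ofLp = s.ofLp := hb.imp (congrArg _) (congrArg _)
    have hG : spectralIntegral (logCharFun ν) α α' a b =
        spectralIntegral (logCharFun ν) α α' t t := by
      unfold spectralIntegral
      congr 1 with y
      rw [prod_eq_of_notMem heq (fun k u v => spectralFactor u v (extendZero _ y k)) hts ha' hb']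
    rw [limitCov_eq, prod_eq_of_mem hlt (fun _ => fbmCov (1 / 2)) hts ha' hb',
      prod_eq_of_notMem hgt (fun _ u v => u * v / (2 * Real.pi)) hts ha' hb', hG]
  have hinc : fbmCov (1 / 2) (t j) (t j) - fbmCov (1 / 2) (t j) (s j) -
      fbmCov (1 / 2) (s j) (t j) + fbmCov (1 / 2) (s j) (s j) = |t j - s j| := by
    simp [fbmCov, abs_sub_comm (s j) (t j)]
    ring
  rw [hW.integral_sub_sq_eq_norm, hcov t t (Or.inl rfl) (Or.inl rfl), hcov t s (Or.inl rfl) (Or.inr rfl),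
    hcov s t (Or.inr rfl) (Or.inl rfl), hcov s s (Or.inr rfl) (Or.inr rfl)]
  have hexp : (|t j - s j| ^ anisoExp α α' H j) ^ 2 = |t j - s j| := by
    rw [anisoExp, if_neg hgt, if_pos hlt, ← Real.rpow_natCast, ← Real.rpow_mul (abs_nonneg _)]
    norm_num
  have hcomb : ∀ (σ b z : ℂ) (A a₁ a₂ a₃ a₄ : ℝ),
      σ * ((a₁ * A : ℝ) : ℂ) * b * z - σ * ((a₂ * A : ℝ) : ℂ) * b * z -
        σ * ((a₃ * A : ℝ) : ℂ) * b * z + σ * ((a₄ * A : ℝ) : ℂ) * b * z =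
      ((a₁ - a₂ - a₃ + a₄ : ℝ) : ℂ) * (σ * (A : ℂ) * b * z) := by
    intros
    push_cast
    ring
  rw [hcomb, hinc, norm_mul, Complex.norm_real, Real.norm_eq_abs, abs_abs, hexp, mul_comm]
  exact mul_le_mul_of_nonneg_right (norm_mul_le_of_le_one (abs_prod_fbmCov_le_one ht _) (abs_prod_mul_self_le_one ht _)
    (norm_spectralIntegral_le hK₁0 hK₁ ht ht)) (abs_nonneg _)

/-- Only the spectral integral changes, and the two products of the covariance are at most 1 on the
cube. -/
lemma IsLimitField.increment_bound_Ieq [IsProbabilityMeasure P]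
    (hW : IsLimitField μ p ν α α' P W)
    (hL : Continuous (logCharFun ν)) {H : Fin d → ℝ} {K₁ : ℝ}
    (hK₁ : ∫⁻ y : Ige α α' → ℝ, ENNReal.ofReal (‖logCharFun ν (extendZero _ y)‖ ^ (-2 : ℤ) *
      ∏ k ∈ Ieq α α', increDecay 1 (extendZero _ y k)) ≤ ENNReal.ofReal K₁)
    {j : Fin d} (hj : gammaZero α α' = ratio α α' j)
    (hK : ∃ K, 0 ≤ K ∧ ∀ h ∈ Set.Icc (0 : ℝ) 1,
      ∫⁻ y : Ige α α' → ℝ, ENNReal.ofReal (‖logCharFun ν (extendZero _ y)‖ ^ (-2 : ℤ) *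
        ∏ k ∈ Ieq α α', increDecay (if k = j then h else 1) (extendZero _ y k)) ≤
      ENNReal.ofReal (K * h ^ (2 * H j))) :
    ∃ C, 0 ≤ C ∧ ∀ t ∈ unitCube d, ∀ s ∈ unitCube d, (∀ k, k ≠ j → t k = s k) →
      ∫ ω, (W t ω - W s ω) ^ 2 ∂P ≤ C * (|t j - s j| ^ anisoExp α α' H j) ^ 2 := by
  have hlt : j ∉ Ilt α α' := by simp [Ilt, hj]
  have heq : j ∈ Ieq α α' := by simp [Ieq, hj]
  have hgt : j ∉ Igt α α' := by simp [Igt, hj]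
  obtain ⟨K, hK0, hK⟩ := hK
  refine ⟨|sigmaSq μ p| * K, by positivity, fun t ht s hs hts => ?_⟩
  have hcov : ∀ a b : EuclideanSpace ℝ (Fin d), (a = t ∨ a = s) → (b = t ∨ b = s) →
      limitCov μ p ν α α' a b = (sigmaSq μ p : ℂ) *
        (∏ k ∈ Ilt α α', fbmCov (1 / 2) (t k) (t k) : ℝ) *
        (∏ k ∈ Igt α α', t k * t k / (2 * Real.pi) : ℝ) *
        spectralIntegral (logCharFun ν) α α' a b := by
    intro a b ha hb
    have ha' : a.ofLp = t.ofLp ∨ a.ofLp = s.ofLp := ha.imp (congrArg _) (congrArg _)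
    have hb' : b.ofLp = t.ofLp ∨ b.ofLp = s.ofLp := hb.imp (congrArg _) (congrArg _)
    rw [limitCov_eq, prod_eq_of_notMem hlt (fun _ => fbmCov (1 / 2)) hts ha' hb',
      prod_eq_of_notMem hgt (fun _ u v => u * v / (2 * Real.pi)) hts ha' hb']
  rw [hW.integral_sub_sq_eq_norm, hcov t t (Or.inl rfl) (Or.inl rfl), hcov t s (Or.inl rfl) (Or.inr rfl),
    hcov s t (Or.inr rfl) (Or.inl rfl), hcov s s (Or.inr rfl) (Or.inr rfl), ← mul_sub, ← mul_sub,
    ← mul_add]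
  have hh : |t j - s j| ∈ Set.Icc (0 : ℝ) 1 := by
    refine ⟨abs_nonneg _, abs_le.2 ⟨?_, ?_⟩⟩ <;>
      linarith [(ht j).1, (ht j).2, (hs j).1, (hs j).2]
  have hexp : (|t j - s j| ^ anisoExp α α' H j) ^ 2 = |t j - s j| ^ (2 * H j) := by
    rw [anisoExp, if_neg hgt, if_neg hlt, ← Real.rpow_natCast, ← Real.rpow_mul (abs_nonneg _)]
    congr 1
    push_cast
    ring
  rw [hexp, mul_assoc |sigmaSq μ p|]
  exact norm_mul_le_of_le_one (abs_prod_fbmCov_le_one ht _) (abs_prod_mul_self_le_one ht _)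
    (norm_spectralIntegral_increment_le hL (mul_nonneg hK0 (Real.rpow_nonneg hh.1 _)) hK₁ ht hs
      heq hts (hK _ hh))

/-- Only the factor t_j s_j / (2π) changes, and its second difference is (t_j - s_j)² / (2π), whence
the exponent 1. -/
lemma IsLimitField.increment_bound_Igt [IsProbabilityMeasure P]
    (hW : IsLimitField μ p ν α α' P W) (H : Fin d → ℝ)
    {K₁ : ℝ} (hK₁0 : 0 ≤ K₁)
    (hK₁ : ∫⁻ y : Ige α α' → ℝ, ENNReal.ofReal (‖logCharFun ν (extendZero _ y)‖ ^ (-2 : ℤ) *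
      ∏ k ∈ Ieq α α', increDecay 1 (extendZero _ y k)) ≤ ENNReal.ofReal K₁)
    {j : Fin d} (hj : ratio α α' j < gammaZero α α') :
    ∃ C, 0 ≤ C ∧ ∀ t ∈ unitCube d, ∀ s ∈ unitCube d, (∀ k, k ≠ j → t k = s k) →
      ∫ ω, (W t ω - W s ω) ^ 2 ∂P ≤ C * (|t j - s j| ^ anisoExp α α' H j) ^ 2 := by
  have hlt : j ∉ Ilt α α' := by simp [Ilt, hj.le]
  have heq : j ∉ Ieq α α' := by simp [Ieq, hj.ne']
  have hgt : j ∈ Igt α α' := by simp [Igt, hj]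
  refine ⟨|sigmaSq μ p| * K₁, by positivity, fun t ht s hs hts => ?_⟩
  have hcov : ∀ a b : EuclideanSpace ℝ (Fin d), (a = t ∨ a = s) → (b = t ∨ b = s) →
      limitCov μ p ν α α' a b = (sigmaSq μ p : ℂ) *
        (∏ k ∈ Ilt α α', fbmCov (1 / 2) (t k) (t k) : ℝ) *
        ((a j * b j / (2 * Real.pi) *
          ∏ k ∈ (Igt α α').erase j, t k * t k / (2 * Real.pi) : ℝ) : ℂ) *
        spectralIntegral (logCharFun ν) α α' t t := by
    intro a b ha hb
    have ha' : a.ofLp = t.ofLp ∨ a.ofLp = s.ofLp := ha.imp (congrArg _) (congrArg _)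
    have hb' : b.ofLp = t.ofLp ∨ b.ofLp = s.ofLp := hb.imp (congrArg _) (congrArg _)
    have hG : spectralIntegral (logCharFun ν) α α' a b =
        spectralIntegral (logCharFun ν) α α' t t := by
      unfold spectralIntegral
      congr 1 with y
      rw [prod_eq_of_notMem heq (fun k u v => spectralFactor u v (extendZero _ y k)) hts ha' hb']
    rw [limitCov_eq, prod_eq_of_notMem hlt (fun _ => fbmCov (1 / 2)) hts ha' hb',
      prod_eq_of_mem hgt (fun _ u v => u * v / (2 * Real.pi)) hts ha' hb', hG]
  rw [hW.integral_sub_sq_eq_norm, hcov t t (Or.inl rfl) (Or.inl rfl), hcov t s (Or.inl rfl) (Or.inr rfl),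
    hcov s t (Or.inr rfl) (Or.inl rfl), hcov s s (Or.inr rfl) (Or.inr rfl)]
  have hcomb : ∀ (σ a z : ℂ) (B : ℝ),
      σ * a * ((t j * t j / (2 * Real.pi) * B : ℝ) : ℂ) * z -
        σ * a * ((t j * s j / (2 * Real.pi) * B : ℝ) : ℂ) * z -
        σ * a * ((s j * t j / (2 * Real.pi) * B : ℝ) : ℂ) * z +
        σ * a * ((s j * s j / (2 * Real.pi) * B : ℝ) : ℂ) * z =
      (((t j - s j) * (t j - s j) / (2 * Real.pi) : ℝ) : ℂ) * (σ * a * (B : ℂ) * z) := by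
    intros
    push_cast
    ring
  rw [hcomb, norm_mul, Complex.norm_real, Real.norm_eq_abs, anisoExp, if_pos hgt, Real.rpow_one,
    mul_comm]
  refine mul_le_mul (norm_mul_le_of_le_one (abs_prod_fbmCov_le_one ht _) (abs_prod_mul_self_le_one ht _)
    (norm_spectralIntegral_le hK₁0 hK₁ ht ht)) (abs_mul_div_two_pi_le ?_) (abs_nonneg _)
    (by positivity)
  rw [abs_mul, sq]

/-- Passing from one point to another by changing the coordinates one at a time. -/
lemma exists_increment_bound_of_coordinates
    (hW2 : ∀ t, MemLp (W t) 2 P) {h : Fin d → ℝ}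
    (hinc : ∀ j, ∃ C, 0 ≤ C ∧ ∀ t ∈ unitCube d, ∀ s ∈ unitCube d, (∀ k, k ≠ j → t k = s k) →
      ∫ ω, (W t ω - W s ω) ^ 2 ∂P ≤ C * (|t j - s j| ^ h j) ^ 2) (S : Finset (Fin d)) :
    ∃ C, 0 ≤ C ∧ ∀ t ∈ unitCube d, ∀ s ∈ unitCube d, (∀ k, k ∉ S → t k = s k) →
      ∫ ω, (W t ω - W s ω) ^ 2 ∂P ≤ C * (∑ j ∈ S, |t j - s j| ^ h j) ^ 2 := by
  induction S using Finset.induction_on with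
  | empty =>
    refine ⟨0, le_rfl, fun t _ s _ hts => ?_⟩
    have : t = s := by
      ext k
      exact hts k (Finset.notMem_empty k)
    simp [this]
  | insert j S hj ih =>
    obtain ⟨B, hB, hBS⟩ := ih
    obtain ⟨C, hC, hCj⟩ := hinc j
    refine ⟨2 * C + 2 * B, by positivity, fun t ht s hs hts => ?_⟩
    -- The intermediate point has coordinate j from s and the others from t. The two steps are
    -- combined by (a + b)² ≤ 2a² + 2b².
    let u : EuclideanSpace ℝ (Fin d) := WithLp.toLp 2 (Function.update t.ofLp j (s j))
    have huj : u j = s j := by simp [u]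
    have huk : ∀ k, k ≠ j → u k = t k := fun k hk => by simp [u, hk]
    have hu : u ∈ unitCube d := fun k => by
      by_cases hk : k = j
      · rw [hk, huj]
        exact hs j
      · rw [huk k hk]
        exact ht k
    have h1 := hCj t ht u hu fun k hk => (huk k hk).symm
    have h2 := hBS u hu s hs fun k hk => by
      by_cases hkj : k = j
      · rw [hkj, huj]
      · rw [huk k hkj]
        exact hts k (by simp [hkj, hk])
    have h3 : ∑ i ∈ S, |u i - s i| ^ h i = ∑ i ∈ S, |t i - s i| ^ h i :=
      Finset.sum_congr rfl fun i hi => by rw [huk i fun h => hj (h ▸ hi)]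
    rw [huj] at h1
    rw [h3] at h2
    rw [Finset.sum_insert hj]
    set a := |t j - s j| ^ h j
    set b := ∑ i ∈ S, |t i - s i| ^ h i
    have ha : 0 ≤ a := by positivity
    have hb : 0 ≤ b := by positivity
    have hi1 : Integrable (fun ω => (W t ω - W u ω) ^ 2) P := ((hW2 t).sub (hW2 u)).integrable_sq
    have hi2 : Integrable (fun ω => (W u ω - W s ω) ^ 2) P := ((hW2 u).sub (hW2 s)).integrable_sq
    calc ∫ ω, (W t ω - W s ω) ^ 2 ∂P
        ≤ ∫ ω, (2 * (W t ω - W u ω) ^ 2 + 2 * (W u ω - W s ω) ^ 2) ∂P := by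
          refine integral_mono ((hW2 t).sub (hW2 s)).integrable_sq
            ((hi1.const_mul 2).add (hi2.const_mul 2)) fun ω => ?_
          simp only
          nlinarith [sq_nonneg ((W t ω - W u ω) - (W u ω - W s ω))]
      _ = 2 * ∫ ω, (W t ω - W u ω) ^ 2 ∂P + 2 * ∫ ω, (W u ω - W s ω) ^ 2 ∂P := by
          rw [integral_add (hi1.const_mul 2) (hi2.const_mul 2), integral_const_mul,
            integral_const_mul]
      _ ≤ 2 * (C * a ^ 2) + 2 * (B * b ^ 2) := by gcongr
      _ ≤ (2 * C + 2 * B) * (a + b) ^ 2 := by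
          have e1 : a ^ 2 ≤ (a + b) ^ 2 := pow_le_pow_left₀ ha (by linarith) 2
          have e2 : b ^ 2 ≤ (a + b) ^ 2 := pow_le_pow_left₀ hb (by linarith) 2
          nlinarith [mul_le_mul_of_nonneg_left e1 hC, mul_le_mul_of_nonneg_left e2 hB]

end Increments

/-! ### The anisotropic distance and the dyadic grids -/

section HolderDist

variable {d : ℕ}

/-- The anisotropic distance with exponents `h`. -/
def holderDist (h : Fin d → ℝ) (s t : EuclideanSpace ℝ (Fin d)) : ℝ :=
  ∑ j, |t j - s j| ^ h j

variable {h : Fin d → ℝ}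

lemma holderDist_nonneg (s t : EuclideanSpace ℝ (Fin d)) : 0 ≤ holderDist h s t :=
  Finset.sum_nonneg fun _ _ => by positivity

lemma holderDist_comm (s t : EuclideanSpace ℝ (Fin d)) : holderDist h s t = holderDist h t s := by
  simp [holderDist, abs_sub_comm]

lemma holderDist_self (hh : ∀ j, 0 < h j) (s : EuclideanSpace ℝ (Fin d)) :
    holderDist h s s = 0 :=
  Finset.sum_eq_zero fun j _ => by rw [sub_self, abs_zero, Real.zero_rpow (hh j).ne']

lemma eq_of_holderDist_eq_zero (hh : ∀ j, 0 < h j) {s t : EuclideanSpace ℝ (Fin d)}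
    (hst : holderDist h s t = 0) : s = t := by
  ext j
  have := (Finset.sum_eq_zero_iff_of_nonneg fun _ _ => by positivity).1 hst j (Finset.mem_univ j)
  rw [Real.rpow_eq_zero (abs_nonneg _) (hh j).ne', abs_eq_zero, sub_eq_zero] at this
  exact this.symm

lemma holderDist_triangle (hh : ∀ j, 0 < h j ∧ h j ≤ 1) (s t u : EuclideanSpace ℝ (Fin d)) :
    holderDist h s u ≤ holderDist h s t + holderDist h t u := by
  rw [holderDist, holderDist, holderDist, ← Finset.sum_add_distrib]
  refine Finset.sum_le_sum fun j _ => ?_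
  calc |u j - s j| ^ h j ≤ (|t j - s j| + |u j - t j|) ^ h j :=
        Real.rpow_le_rpow (abs_nonneg _) (by
          rw [add_comm]
          exact abs_sub_le _ _ _) (hh j).1.le
    _ ≤ _ := Real.rpow_add_le_add_rpow (abs_nonneg _) (abs_nonneg _) (hh j).1.le (hh j).2

lemma holderDist_le (hh : ∀ j, 0 < h j) {s t : EuclideanSpace ℝ (Fin d)} (hs : s ∈ unitCube d)
    (ht : t ∈ unitCube d) : holderDist h s t ≤ d := by
  calc holderDist h s t ≤ ∑ _j : Fin d, (1 : ℝ) := Finset.sum_le_sum fun j _ => by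
        refine Real.rpow_le_one (abs_nonneg _) (abs_le.2 ⟨?_, ?_⟩) (hh j).le <;>
          linarith [(hs j).1, (hs j).2, (ht j).1, (ht j).2]
    _ = d := by simp

lemma continuous_holderDist (hh : ∀ j, 0 < h j) :
    Continuous fun x : EuclideanSpace ℝ (Fin d) × EuclideanSpace ℝ (Fin d) =>
      holderDist h x.1 x.2 := by
  unfold holderDist
  refine continuous_finsetSum _ fun j _ => Continuous.rpow_const ?_ fun _ => Or.inr (hh j).le
  fun_prop

/-- The point with coordinates `i_j / 2 ^ k`. -/
def gridPoint (k : ℕ) (i : Fin d → Fin (2 ^ k + 1)) : EuclideanSpace ℝ (Fin d) :=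
  WithLp.toLp 2 fun j => (i j : ℕ) / (2 : ℝ) ^ k

/-- The dyadic grid of mesh `2 ^ (-k)` in the unit cube. -/
def grid (d k : ℕ) : Set (EuclideanSpace ℝ (Fin d)) := Set.range (gridPoint k)

lemma mem_grid_iff {k : ℕ} {u : EuclideanSpace ℝ (Fin d)} :
    u ∈ grid d k ↔ ∀ j, ∃ i : ℕ, i ≤ 2 ^ k ∧ u j = i / (2 : ℝ) ^ k := by
  constructor
  · rintro ⟨i, rfl⟩ j
    exact ⟨i j, Nat.lt_succ_iff.1 (i j).2, rfl⟩
  · intro hu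
    choose i hi hui using hu
    refine ⟨fun j => ⟨i j, Nat.lt_succ_iff.2 (hi j)⟩, ?_⟩
    ext j
    simp [gridPoint, hui]

lemma grid_subset_unitCube (k : ℕ) : grid d k ⊆ unitCube d := by
  intro u hu j
  obtain ⟨i, hi, h⟩ := mem_grid_iff.1 hu j
  have hi' : (i : ℝ) ≤ 2 ^ k := by exact_mod_cast hi
  rw [h]
  exact ⟨by positivity, div_le_one_of_le₀ hi' (by positivity)⟩

lemma grid_mono : Monotone (grid d) := by
  refine monotone_nat_of_le_succ fun k u hu => mem_grid_iff.2 fun j => ?_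
  obtain ⟨i, hi, h⟩ := mem_grid_iff.1 hu j
  refine ⟨2 * i, by rw [pow_succ]; omega, ?_⟩
  rw [h, pow_succ]
  push_cast
  field_simp

/-- The grid point below `t`. -/
def floorPoint (k : ℕ) (t : EuclideanSpace ℝ (Fin d)) : EuclideanSpace ℝ (Fin d) :=
  WithLp.toLp 2 fun j => (⌊t j * 2 ^ k⌋₊ : ℝ) / (2 : ℝ) ^ k

lemma floorPoint_mem_grid {t : EuclideanSpace ℝ (Fin d)} (ht : t ∈ unitCube d) (k : ℕ) :
    floorPoint k t ∈ grid d k := by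
  refine mem_grid_iff.2 fun j => ⟨⌊t j * 2 ^ k⌋₊, ?_, rfl⟩
  refine Nat.floor_le_of_le ?_
  push_cast
  exact mul_le_of_le_one_left (by positivity) (ht j).2

lemma floorPoint_eq_self {k : ℕ} {t : EuclideanSpace ℝ (Fin d)} (ht : t ∈ grid d k) :
    floorPoint k t = t := by
  ext j
  obtain ⟨i, -, h⟩ := mem_grid_iff.1 ht j
  simp [floorPoint, h]

lemma abs_sub_floorPoint_le {t : EuclideanSpace ℝ (Fin d)} (ht : t ∈ unitCube d) (k : ℕ)
    (j : Fin d) : |floorPoint k t j - t j| ≤ ((1 : ℝ) / 2) ^ k := by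
  have h2 : (0 : ℝ) < 2 ^ k := by positivity
  have h1 := Nat.floor_le (mul_nonneg (ht j).1 h2.le)
  have h3 := Nat.lt_floor_add_one (t j * 2 ^ k)
  have e : floorPoint k t j - t j = -((t j * 2 ^ k - ⌊t j * 2 ^ k⌋₊) / 2 ^ k) := by
    simp only [floorPoint]
    field_simp
    ring
  rw [e, abs_neg, abs_of_nonneg (div_nonneg (by linarith) h2.le), one_div, inv_pow,
    div_le_iff₀ h2, inv_mul_cancel₀ h2.ne']
  linarith

/-- On lengths at most 1 the smallest exponent is the worst, so 2^{-η} is the geometric rate of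
approximation in every direction. -/
lemma holderDist_floorPoint_le {η : ℝ} (hη : ∀ j, η ≤ h j) (hη0 : 0 < η)
    {t : EuclideanSpace ℝ (Fin d)} (ht : t ∈ unitCube d) (k : ℕ) :
    holderDist h t (floorPoint k t) ≤ d * (((1 : ℝ) / 2) ^ η) ^ k := by
  calc holderDist h t (floorPoint k t) ≤ ∑ _j : Fin d, (((1 : ℝ) / 2) ^ η) ^ k :=
        Finset.sum_le_sum fun j _ => by
          calc |floorPoint k t j - t j| ^ h j ≤ (((1 : ℝ) / 2) ^ k) ^ h j :=
                Real.rpow_le_rpow (abs_nonneg _) (abs_sub_floorPoint_le ht k j)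
                  (hη0.le.trans (hη j))
            _ ≤ (((1 : ℝ) / 2) ^ k) ^ η :=
                Real.rpow_le_rpow_of_exponent_ge (by positivity)
                  (pow_le_one₀ (by norm_num) (by norm_num)) (hη j)
            _ = (((1 : ℝ) / 2) ^ η) ^ k := by
                rw [← Real.rpow_natCast, ← Real.rpow_natCast, ← Real.rpow_mul (by norm_num),
                  ← Real.rpow_mul (by norm_num), mul_comm]
    _ = _ := by simp

lemma tendsto_floorPoint {t : EuclideanSpace ℝ (Fin d)} (ht : t ∈ unitCube d) :
    Tendsto (fun k => floorPoint k t) atTop (𝓝 t) := by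
  have h : Tendsto (fun k => (floorPoint k t).ofLp) atTop (𝓝 t.ofLp) := by
    refine tendsto_pi_nhds.2 fun j => tendsto_iff_dist_tendsto_zero.2 ?_
    refine squeeze_zero (fun _ => dist_nonneg) (fun k => ?_)
      (tendsto_pow_atTop_nhds_zero_of_lt_one (r := (1 : ℝ) / 2) (by norm_num) (by norm_num))
    rw [Real.dist_eq]
    exact abs_sub_floorPoint_le ht k j
  exact ((PiLp.continuous_toLp 2 _).tendsto _).comp h

end HolderDist

/-! ### Deterministic chaining -/

section Chaining

variable {d : ℕ} {h : Fin d → ℝ}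

/-- A distance x is matched with the level n at which θ^n is about x, so n is of order log(1/x). For
x ≥ 1 the level 0 serves. -/
lemma exists_scale {θ : ℝ} (hθ0 : 0 < θ) (hθ1 : θ < 1) {D : ℝ} (hD : 1 ≤ D) :
    ∃ c, 0 < c ∧ ∀ x, 0 < x → x ≤ D → ∃ n : ℕ, θ ^ n ≤ x / θ ∧
      ((n : ℝ) + 1) ≤ c * Real.log (1 + x⁻¹) := by
  have hℓ : 0 < Real.log (1 + D⁻¹) := Real.log_pos (by
    have : 0 < D⁻¹ := by positivity
    linarith)
  have hθl : 0 < -Real.log θ := neg_pos.2 (Real.log_neg hθ0 hθ1)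
  -- The second summand pays for the +1: on (0, D] the logarithm is at least log(1 + 1/D).
  refine ⟨1 / (-Real.log θ) + 1 / Real.log (1 + D⁻¹), by positivity, fun x hx hxD => ?_⟩
  have hlog : Real.log (1 + D⁻¹) ≤ Real.log (1 + x⁻¹) := by
    refine Real.log_le_log (by positivity) ?_
    have : D⁻¹ ≤ x⁻¹ := inv_anti₀ hx hxD
    linarith
  have h1 : 1 ≤ 1 / Real.log (1 + D⁻¹) * Real.log (1 + x⁻¹) := by
    rw [one_div, inv_mul_eq_div, le_div_iff₀ hℓ]
    linarith
  rcases le_total x 1 with hx1 | hx1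
  · obtain ⟨n, hn1, hn2⟩ := exists_nat_pow_near_of_lt_one hx hx1 hθ0 hθ1
    refine ⟨n, ?_, ?_⟩
    · rw [le_div_iff₀ hθ0, ← pow_succ]
      exact hn1.le
    · have h2 : n * (-Real.log θ) ≤ Real.log (1 + x⁻¹) := by
        have h3 : Real.log x ≤ n * Real.log θ := by
          rw [← Real.log_pow]
          exact Real.log_le_log hx hn2
        have h4 : Real.log x⁻¹ ≤ Real.log (1 + x⁻¹) :=
          Real.log_le_log (by positivity) (by linarith)
        rw [Real.log_inv] at h4
        linarith
      have h5 : (n : ℝ) ≤ 1 / (-Real.log θ) * Real.log (1 + x⁻¹) := by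
        rwa [one_div, inv_mul_eq_div, le_div_iff₀ hθl]
      rw [add_mul]
      exact add_le_add h5 h1
  · refine ⟨0, ?_, ?_⟩
    · rw [pow_zero, le_div_iff₀ hθ0]
      linarith
    · have h6 : 0 ≤ 1 / (-Real.log θ) * Real.log (1 + x⁻¹) :=
        mul_nonneg (by positivity) (hℓ.le.trans hlog)
      rw [add_mul]
      push_cast
      linarith

/-- A function whose increments on the dyadic grids are controlled has increments along the chain
of grid points below a dyadic point that sum up to the last scale. -/
lemma abs_sub_floorPoint_chain_le (hh : ∀ j, 0 < h j ∧ h j ≤ 1) {η : ℝ} (hη : ∀ j, η ≤ h j)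
    (hη0 : 0 < η) {f : EuclideanSpace ℝ (Fin d) → ℝ} {Y : ℝ} (hY : 0 ≤ Y)
    (hf : ∀ k, ∀ u ∈ grid d k, ∀ v ∈ grid d k,
      |f u - f v| ≤ Y * Real.sqrt (k + 1) * holderDist h u v)
    {t : EuclideanSpace ℝ (Fin d)} (ht : t ∈ unitCube d) (n M : ℕ) :
    |f (floorPoint (n + M) t) - f (floorPoint n t)| ≤
      Y * (2 * d) * Real.sqrt (n + 1) * (((1 : ℝ) / 2) ^ η) ^ n *
        ∑ m ∈ Finset.range M, ((m : ℝ) + 2) * (((1 : ℝ) / 2) ^ η) ^ m := by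
  set θ : ℝ := ((1 : ℝ) / 2) ^ η with hθ
  have hθ0 : 0 < θ := by positivity
  have hθ1 : θ ≤ 1 := Real.rpow_le_one (by norm_num) (by norm_num) hη0.le
  induction M with
  | zero => simp
  | succ M ih =>
    have hstep : |f (floorPoint (n + (M + 1)) t) - f (floorPoint (n + M) t)| ≤
        Y * (2 * d) * Real.sqrt (n + 1) * θ ^ n * (((M : ℝ) + 2) * θ ^ M) := by
      have h1 := hf (n + (M + 1)) _ (floorPoint_mem_grid ht _) _
        (grid_mono (by omega) (floorPoint_mem_grid ht (n + M)))
      have h2 : holderDist h (floorPoint (n + (M + 1)) t) (floorPoint (n + M) t) ≤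
          2 * d * θ ^ (n + M) := by
        refine (holderDist_triangle hh _ t _).trans ?_
        rw [holderDist_comm]
        have e1 := holderDist_floorPoint_le hη hη0 ht (n + (M + 1))
        have e2 := holderDist_floorPoint_le hη hη0 ht (n + M)
        have e3 : θ ^ (n + (M + 1)) ≤ θ ^ (n + M) :=
          pow_le_pow_of_le_one hθ0.le hθ1 (by omega)
        have e4 : (d : ℝ) * θ ^ (n + (M + 1)) ≤ d * θ ^ (n + M) := by gcongr
        linarith
      -- Here n + M + 2 ≤ (n + 1)(M + 2) separates the starting level from the length of the chain.
      -- The crude factor M + 2 is still summable against θ^M.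
      have h3 : Real.sqrt (((n + (M + 1) : ℕ) : ℝ) + 1) ≤ Real.sqrt (n + 1) * ((M : ℝ) + 2) := by
        have e1 : Real.sqrt ((M : ℝ) + 2) ≤ (M : ℝ) + 2 := by
          rw [Real.sqrt_le_left (by positivity)]
          nlinarith [(Nat.cast_nonneg M : (0 : ℝ) ≤ M)]
        refine le_trans ?_ (mul_le_mul_of_nonneg_left e1 (Real.sqrt_nonneg _))
        rw [← Real.sqrt_mul (by positivity)]
        refine Real.sqrt_le_sqrt ?_
        push_cast
        nlinarith [(Nat.cast_nonneg M : (0 : ℝ) ≤ M), (Nat.cast_nonneg n : (0 : ℝ) ≤ n),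
          mul_nonneg (Nat.cast_nonneg n : (0 : ℝ) ≤ n) (Nat.cast_nonneg M : (0 : ℝ) ≤ M)]
      calc |f (floorPoint (n + (M + 1)) t) - f (floorPoint (n + M) t)|
          ≤ Y * Real.sqrt (((n + (M + 1) : ℕ) : ℝ) + 1) *
            holderDist h (floorPoint (n + (M + 1)) t) (floorPoint (n + M) t) := h1
        _ ≤ Y * (Real.sqrt (n + 1) * ((M : ℝ) + 2)) * (2 * d * θ ^ (n + M)) := by
            gcongr
            exact holderDist_nonneg _ _
        _ = _ := by
            rw [pow_add]
            ring
    rw [Finset.sum_range_succ, mul_add]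
    refine (abs_sub_le _ (f (floorPoint (n + M) t)) _).trans ?_
    rw [add_comm]
    exact add_le_add ih hstep

/-- From the increments on the dyadic grids to the modulus of continuity on the dyadic points. -/
lemma exists_modulus_const (hd : 1 ≤ d) (hh : ∀ j, 0 < h j ∧ h j ≤ 1) :
    ∃ C, 0 ≤ C ∧ ∀ (f : EuclideanSpace ℝ (Fin d) → ℝ) (Y : ℝ), 0 ≤ Y →
      (∀ k, ∀ u ∈ grid d k, ∀ v ∈ grid d k,
        |f u - f v| ≤ Y * Real.sqrt (k + 1) * holderDist h u v) →
      ∀ k, ∀ s ∈ grid d k, ∀ t ∈ grid d k,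
        |f t - f s| ≤ Y * C * (holderDist h s t *
          Real.sqrt (Real.log (1 + (holderDist h s t)⁻¹))) := by
  obtain ⟨η, hη0, hη⟩ : ∃ η, 0 < η ∧ ∀ j, η ≤ h j := by
    obtain ⟨i, -, hi⟩ := Finset.exists_min_image Finset.univ h ⟨⟨0, hd⟩, Finset.mem_univ _⟩
    exact ⟨h i, (hh i).1, fun j => hi j (Finset.mem_univ j)⟩
  set θ : ℝ := ((1 : ℝ) / 2) ^ η with hθ
  have hθ0 : 0 < θ := by positivity
  have hθ1 : θ < 1 := Real.rpow_lt_one (by norm_num) (by norm_num) hη0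
  have hd' : (1 : ℝ) ≤ d := by exact_mod_cast hd
  obtain ⟨c, hc0, hc⟩ := exists_scale hθ0 hθ1 hd'
  have hsum : Summable fun m : ℕ => ((m : ℝ) + 2) * θ ^ m := by
    have h1 : Summable fun m : ℕ => (m : ℝ) * θ ^ m := by
      simpa using summable_pow_mul_geometric_of_norm_lt_one 1
        (show ‖θ‖ < 1 by rwa [Real.norm_of_nonneg hθ0.le])
    have h2 := (summable_geometric_of_lt_one hθ0.le hθ1).mul_left 2
    refine (h1.add h2).congr fun m => by ring
  set S : ℝ := ∑' m : ℕ, ((m : ℝ) + 2) * θ ^ m with hS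
  have hS0 : 0 ≤ S := tsum_nonneg fun m => by positivity
  have hSM : ∀ M, ∑ m ∈ Finset.range M, ((m : ℝ) + 2) * θ ^ m ≤ S := fun M =>
    hsum.sum_le_tsum _ fun m _ => by positivity
  refine ⟨Real.sqrt c * ((4 * d * S + 2 * d) / θ + 1), by positivity, fun f Y hY hf k s hs t ht => ?_⟩
  set x := holderDist h s t with hx
  rcases (holderDist_nonneg (h := h) s t).eq_or_lt with h0 | h0
  · rw [eq_of_holderDist_eq_zero (fun j => (hh j).1) h0.symm, sub_self, abs_zero, hx, ← h0]
    simp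
  have hsc := grid_subset_unitCube k hs
  have htc := grid_subset_unitCube k ht
  obtain ⟨n, hn1, hn2⟩ := hc x h0 (holderDist_le (fun j => (hh j).1) hsc htc)
  -- A chain of k steps from level n reaches u itself, because u lies on the grid of level n + k.
  have hchain : ∀ u ∈ grid d k, |f u - f (floorPoint n u)| ≤
      Y * (2 * d) * Real.sqrt (n + 1) * θ ^ n * S := fun u hu => by
    have h1 := abs_sub_floorPoint_chain_le hh hη hη0 hY hf (grid_subset_unitCube k hu) n k
    rw [floorPoint_eq_self (grid_mono (by omega) hu : u ∈ grid d (n + k))] at h1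
    exact h1.trans (mul_le_mul_of_nonneg_left (hSM k) (by positivity))
  have hmid : |f (floorPoint n t) - f (floorPoint n s)| ≤
      Y * Real.sqrt (n + 1) * (x + 2 * d * θ ^ n) := by
    refine (hf n _ (floorPoint_mem_grid htc n) _ (floorPoint_mem_grid hsc n)).trans ?_
    gcongr
    have e1 := holderDist_floorPoint_le hη hη0 hsc n
    have e2 := holderDist_floorPoint_le hη hη0 htc n
    have e3 := holderDist_triangle hh (floorPoint n t) t (floorPoint n s)
    have e4 := holderDist_triangle hh t s (floorPoint n s)
    rw [holderDist_comm (floorPoint n t) t] at e3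
    rw [holderDist_comm t s] at e4
    linarith
  have hsqrt : Real.sqrt (n + 1) ≤ Real.sqrt c * Real.sqrt (Real.log (1 + x⁻¹)) := by
    rw [← Real.sqrt_mul hc0.le]
    exact Real.sqrt_le_sqrt hn2
  have htri : |f t - f s| ≤ |f t - f (floorPoint n t)| +
      |f (floorPoint n t) - f (floorPoint n s)| + |f s - f (floorPoint n s)| := by
    have e1 := abs_sub_le (f t) (f (floorPoint n t)) (f s)
    have e2 := abs_sub_le (f (floorPoint n t)) (f (floorPoint n s)) (f s)
    rw [abs_sub_comm (f (floorPoint n s)) (f s)] at e2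
    linarith
  calc |f t - f s| ≤ Y * Real.sqrt (n + 1) * ((4 * d * S + 2 * d) * θ ^ n + x) := by
        linarith [hchain s hs, hchain t ht]
    _ ≤ Y * (Real.sqrt c * Real.sqrt (Real.log (1 + x⁻¹))) *
          ((4 * d * S + 2 * d) * (x / θ) + x) := by gcongr
    _ = _ := by ring

end Chaining

/-! ### Gaussian increments on the grids and the modification -/

section

variable {d : ℕ} {Ω : Type*} [MeasurableSpace Ω] {P : Measure Ω}

lemma lintegral_exp_le_of_hasGaussianLaw {X : Ω → ℝ} (hX : HasGaussianLaw X P)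
    (h0 : ∫ ω, X ω ∂P = 0) {l b : ℝ} (hb : l ^ 2 * ∫ ω, X ω ^ 2 ∂P ≤ b) :
    ∫⁻ ω, ENNReal.ofReal (Real.exp (l * X ω)) ∂P ≤ ENNReal.ofReal (Real.exp (b / 2)) := by
  have hmgf := mgf_gaussianReal hX.map_eq_gaussianReal l
  have hvar : Var[X; P] = ∫ ω, X ω ^ 2 ∂P :=
    variance_of_integral_eq_zero hX.aemeasurable h0
  -- If the exponential were not integrable, its integral would be 0 by convention, whereas the
  -- Gaussian formula is positive.
  have hint : Integrable (fun ω => Real.exp (l * X ω)) P := by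
    by_contra hni
    have : mgf X P l = 0 := integral_undef hni
    rw [this] at hmgf
    exact (Real.exp_pos _).ne hmgf
  rw [← ofReal_integral_eq_lintegral_ofReal hint (ae_of_all _ fun _ => (Real.exp_pos _).le)]
  refine ENNReal.ofReal_le_ofReal ?_
  change mgf X P l ≤ _
  rw [hmgf, h0, Real.coe_toNNReal _ (variance_nonneg _ _), hvar]
  refine Real.exp_le_exp.2 ?_
  linarith

section Grid

variable {h : Fin d → ℝ} {V : EuclideanSpace ℝ (Fin d) → Ω → ℝ}

/-- The increments of a Gaussian process on all dyadic grids. -/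
lemma exists_grid_bound (hh : ∀ j, 0 < h j) (hVm : ∀ t, Measurable (V t))
    (hVg : ∀ s t, HasGaussianLaw (fun ω => V t ω - V s ω) P)
    (hV0 : ∀ s t, ∫ ω, (V t ω - V s ω) ∂P = 0) {C : ℝ} (hC : 0 ≤ C)
    (hVC : ∀ s ∈ unitCube d, ∀ t ∈ unitCube d,
      ∫ ω, (V t ω - V s ω) ^ 2 ∂P ≤ C * holderDist h s t ^ 2) :
    ∃ Y : Ω → ℝ, Measurable Y ∧ (∀ ω, 0 ≤ Y ω) ∧ ∀ᵐ ω ∂P, ∀ k, ∀ u ∈ grid d k, ∀ v ∈ grid d k,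
      |V u ω - V v ω| ≤ Y ω * Real.sqrt (k + 1) * holderDist h u v := by
  let ix : ℕ → Type := fun k => (Fin d → Fin (2 ^ k + 1)) × (Fin d → Fin (2 ^ k + 1))
  -- The normalisation makes l² times the variance at most C (k + 1). If the distance is 0, then l
  -- is 0 by convention.
  let l : (k : ℕ) → ix k → ℝ := fun k i =>
    Real.sqrt (k + 1) / holderDist h (gridPoint k i.1) (gridPoint k i.2)
  -- The term 2d log 2 pays for the at most 2^{2d(k+1)} pairs at level k, one more log 2 makes the
  -- levels summable, and C / 2 absorbs the Gaussian moment.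
  let A : ℝ := (2 * d + 1) * Real.log 2 + C / 2
  have hA : 0 ≤ A := by
    have := Real.log_nonneg one_le_two
    positivity
  let F : (k : ℕ) → ix k → Ω → ENNReal := fun k i ω => ENNReal.ofReal (Real.exp (-(A * (k + 1)))) *
    ENNReal.ofReal (Real.exp (l k i * (V (gridPoint k i.2) ω - V (gridPoint k i.1) ω)))
  have hFm : ∀ k i, Measurable (F k i) := fun k i => by
    have h1 := hVm (gridPoint k i.1)
    have h2 := hVm (gridPoint k i.2)
    fun_prop
  have hF : ∀ k i, ∫⁻ ω, F k i ω ∂P ≤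
      ENNReal.ofReal (Real.exp (-((2 * d + 1) * Real.log 2 * (k + 1)))) := fun k i => by
    have hb : l k i ^ 2 * ∫ ω, (V (gridPoint k i.2) ω - V (gridPoint k i.1) ω) ^ 2 ∂P ≤
        C * (k + 1) := by
      have h1 := hVC _ (grid_subset_unitCube k ⟨i.1, rfl⟩) _ (grid_subset_unitCube k ⟨i.2, rfl⟩)
      refine (mul_le_mul_of_nonneg_left h1 (sq_nonneg _)).trans ?_
      simp only [l]
      rw [div_pow, Real.sq_sqrt (by positivity)]
      rcases eq_or_ne (holderDist h (gridPoint k i.1) (gridPoint k i.2)) 0 with h0 | h0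
      · rw [h0]
        simp only [ne_eq, OfNat.ofNat_ne_zero, not_false_eq_true, zero_pow, mul_zero]
        positivity
      · refine le_of_eq ?_
        field_simp
    calc ∫⁻ ω, F k i ω ∂P = ENNReal.ofReal (Real.exp (-(A * (k + 1)))) * ∫⁻ ω, ENNReal.ofReal
          (Real.exp (l k i * (V (gridPoint k i.2) ω - V (gridPoint k i.1) ω))) ∂P :=
          lintegral_const_mul' _ _ ENNReal.ofReal_ne_top
      _ ≤ ENNReal.ofReal (Real.exp (-(A * (k + 1)))) *
          ENNReal.ofReal (Real.exp (C * (k + 1) / 2)) :=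
          mul_le_mul_right (lintegral_exp_le_of_hasGaussianLaw (hVg _ _) (hV0 _ _) hb) _
      _ = _ := by
          rw [← ENNReal.ofReal_mul (Real.exp_pos _).le, ← Real.exp_add]
          congr 2
          simp only [A]
          ring
  have hcard : ∀ k, (Fintype.card (ix k) : ℝ) ≤ Real.exp (2 * d * Real.log 2 * (k + 1)) :=
    fun k => by
      have h1 : (2 : ℝ) ^ k + 1 ≤ 2 ^ (k + 1) := by
        rw [pow_succ]
        linarith [one_le_pow₀ (n := k) (one_le_two (α := ℝ))]
      have h2 : Real.exp (2 * d * Real.log 2 * (k + 1)) = (2 ^ (k + 1)) ^ (2 * d) := by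
        rw [← pow_mul, ← Real.rpow_natCast, Real.rpow_def_of_pos two_pos]
        congr 1
        push_cast
        ring
      have h3 : (Fintype.card (ix k) : ℝ) = ((2 : ℝ) ^ k + 1) ^ (2 * d) := by
        simp [ix, two_mul, pow_add]
      rw [h2, h3]
      exact pow_le_pow_left₀ (by positivity) h1 _
  let T : Ω → ENNReal := fun ω => ∑' k, ∑ i, F k i ω
  have hTm : Measurable T :=
    Measurable.tsum fun k => Finset.measurable_sum _ fun i _ => hFm k i
  have hT : ∫⁻ ω, T ω ∂P ≠ ⊤ := by
    have h1 : ∀ k, ∫⁻ ω, ∑ i, F k i ω ∂P ≤ ENNReal.ofReal ((1 / 2) ^ (k + 1)) := fun k => by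
      rw [lintegral_finsetSum _ fun i _ => hFm k i]
      refine (Finset.sum_le_sum fun i _ => hF k i).trans ?_
      rw [Finset.sum_const, Finset.card_univ, nsmul_eq_mul, ← ENNReal.ofReal_natCast,
        ← ENNReal.ofReal_mul (Nat.cast_nonneg _)]
      refine ENNReal.ofReal_le_ofReal ((mul_le_mul_of_nonneg_right (hcard k)
        (Real.exp_pos _).le).trans (le_of_eq ?_))
      rw [← Real.exp_add, ← Real.rpow_natCast, one_div, Real.inv_rpow two_pos.le,
        ← Real.rpow_neg two_pos.le, Real.rpow_def_of_pos two_pos]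
      congr 1
      push_cast
      ring
    have h2 : Summable fun k : ℕ => ((1 : ℝ) / 2) ^ (k + 1) :=
      (summable_nat_add_iff 1).2 summable_geometric_two
    rw [lintegral_tsum fun k => (Finset.measurable_sum _ fun i _ => hFm k i).aemeasurable]
    refine ne_top_of_le_ne_top ?_ (ENNReal.tsum_le_tsum h1)
    rw [← ENNReal.ofReal_tsum_of_nonneg (fun k => by positivity) h2]
    exact ENNReal.ofReal_ne_top
  -- Each summand is at most T. Taking logarithms gives l times the increment ≤ A (k + 1) + log T,
  -- and dividing by l leaves the factor √(k + 1).
  refine ⟨fun ω => A + |Real.log (T ω).toReal|, ?_, fun ω => by positivity, ?_⟩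
  · exact measurable_const.add (Real.measurable_log.comp hTm.ennreal_toReal).abs
  filter_upwards [ae_lt_top hTm hT] with ω hω
  have key : ∀ k, ∀ u ∈ grid d k, ∀ v ∈ grid d k, V v ω - V u ω ≤
      (A + |Real.log (T ω).toReal|) * Real.sqrt (k + 1) * holderDist h u v := by
    rintro k _ ⟨i, rfl⟩ _ ⟨i', rfl⟩
    rcases (holderDist_nonneg (h := h) (gridPoint k i) (gridPoint k i')).eq_or_lt with h0 | h0
    · rw [eq_of_holderDist_eq_zero hh h0.symm, sub_self, holderDist_self hh, mul_zero]
    have h1 : F k (i, i') ω ≤ T ω :=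
      (Finset.single_le_sum (f := fun i => F k i ω) (fun _ _ => zero_le)
        (Finset.mem_univ (i, i'))).trans (ENNReal.le_tsum k)
    have h2 : Real.exp (-(A * (k + 1)) + l k (i, i') * (V (gridPoint k i') ω - V (gridPoint k i) ω))
        ≤ (T ω).toReal := by
      have := ENNReal.toReal_mono hω.ne h1
      simp only [F] at this
      rwa [← ENNReal.ofReal_mul (Real.exp_pos _).le, ← Real.exp_add,
        ENNReal.toReal_ofReal (Real.exp_pos _).le] at this
    have h3 := Real.log_le_log (Real.exp_pos _) h2
    rw [Real.log_exp] at h3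
    have hs : 0 < Real.sqrt ((k : ℝ) + 1) := by positivity
    have hs1 : 1 ≤ (k : ℝ) + 1 := by linarith [(Nat.cast_nonneg k : (0 : ℝ) ≤ k)]
    have h4 : l k (i, i') * (V (gridPoint k i') ω - V (gridPoint k i) ω) ≤
        (A + |Real.log (T ω).toReal|) * (k + 1) := by
      have e1 := le_abs_self (Real.log (T ω).toReal)
      have e2 : |Real.log (T ω).toReal| ≤ |Real.log (T ω).toReal| * (k + 1) :=
        le_mul_of_one_le_right (abs_nonneg _) hs1
      linarith
    simp only [l] at h4
    rw [div_mul_eq_mul_div, div_le_iff₀ h0] at h4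
    have h5 : Real.sqrt ((k : ℝ) + 1) * Real.sqrt ((k : ℝ) + 1) = k + 1 :=
      Real.mul_self_sqrt (by positivity)
    refine le_of_mul_le_mul_left (h4.trans (le_of_eq ?_)) hs
    linear_combination -(A + |Real.log (T ω).toReal|) *
      holderDist h (gridPoint k i) (gridPoint k i') * h5
  intro k u hu v hv
  rw [abs_le]
  have h1 := key k u hu v hv
  have h2 := key k v hv u hu
  rw [holderDist_comm v u] at h2
  constructor <;> linarith

/-- The modulus of continuity on the dyadic points. -/
lemma exists_dyadic_modulus (hd : 1 ≤ d) (hh : ∀ j, 0 < h j ∧ h j ≤ 1)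
    (hVm : ∀ t, Measurable (V t)) (hVg : ∀ s t, HasGaussianLaw (fun ω => V t ω - V s ω) P)
    (hV0 : ∀ s t, ∫ ω, (V t ω - V s ω) ∂P = 0) {C : ℝ} (hC : 0 ≤ C)
    (hVC : ∀ s ∈ unitCube d, ∀ t ∈ unitCube d,
      ∫ ω, (V t ω - V s ω) ^ 2 ∂P ≤ C * holderDist h s t ^ 2) :
    ∃ Z : Ω → ℝ, Measurable Z ∧ (∀ ω, 0 ≤ Z ω) ∧ ∀ᵐ ω ∂P, ∀ k, ∀ s ∈ grid d k, ∀ t ∈ grid d k,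
      |V t ω - V s ω| ≤ Z ω * (holderDist h s t *
        Real.sqrt (Real.log (1 + (holderDist h s t)⁻¹))) := by
  obtain ⟨Y, hYm, hY0, hY⟩ := exists_grid_bound (fun j => (hh j).1) hVm hVg hV0 hC hVC
  obtain ⟨K, hK0, hK⟩ := exists_modulus_const hd hh
  refine ⟨fun ω => Y ω * K, hYm.mul_const K, fun ω => mul_nonneg (hY0 ω) hK0, ?_⟩
  filter_upwards [hY] with ω hω
  exact hK (fun t => V t ω) (Y ω) (hY0 ω) hω

end Grid

section Modification

/-- This modulus without a logarithm is crude, but it suffices to show that the values along the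
grid points form a Cauchy sequence. -/
lemma mul_sqrt_log_le_sqrt {x : ℝ} (hx : 0 ≤ x) :
    x * Real.sqrt (Real.log (1 + x⁻¹)) ≤ Real.sqrt x := by
  rcases hx.eq_or_lt with rfl | hx
  · simp
  have h1 : Real.log (1 + x⁻¹) ≤ x⁻¹ := by
    have := Real.log_le_sub_one_of_pos (show 0 < 1 + x⁻¹ by positivity)
    linarith
  calc x * Real.sqrt (Real.log (1 + x⁻¹)) ≤ x * Real.sqrt x⁻¹ := by gcongr
    _ = Real.sqrt x := by
      rw [Real.sqrt_inv, ← div_eq_mul_inv, Real.div_sqrt]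

variable {h : Fin d → ℝ} {f : EuclideanSpace ℝ (Fin d) → ℝ} {z : ℝ}

/-- The limit along the grid points below `t`. -/
def gridLimit (f : EuclideanSpace ℝ (Fin d) → ℝ) (t : EuclideanSpace ℝ (Fin d)) : ℝ :=
  limUnder atTop fun n => f (floorPoint n t)

lemma tendsto_gridLimit (hh : ∀ j, 0 < h j ∧ h j ≤ 1) (hz : 0 ≤ z)
    (hf : ∀ k, ∀ s ∈ grid d k, ∀ t ∈ grid d k, |f t - f s| ≤ z * (holderDist h s t *
      Real.sqrt (Real.log (1 + (holderDist h s t)⁻¹))))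
    {t : EuclideanSpace ℝ (Fin d)} (ht : t ∈ unitCube d) :
    Tendsto (fun n => f (floorPoint n t)) atTop (𝓝 (gridLimit f t)) := by
  refine CauchySeq.tendsto_limUnder ?_
  have hlim : Tendsto (fun n => holderDist h t (floorPoint n t)) atTop (𝓝 0) := by
    have h1 := ((continuous_holderDist fun j => (hh j).1).tendsto (t, t)).comp
      (tendsto_const_nhds.prodMk_nhds (tendsto_floorPoint ht))
    rwa [holderDist_self fun j => (hh j).1] at h1
  have hcauchy : ∀ m n, |f (floorPoint n t) - f (floorPoint m t)| ≤
      z * Real.sqrt (holderDist h t (floorPoint m t) + holderDist h t (floorPoint n t)) := by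
    intro m n
    -- The bound is available on a single grid only; both points lie on the finer of the two.
    refine (hf (max m n) _ (grid_mono (le_max_left m n) (floorPoint_mem_grid ht m)) _
      (grid_mono (le_max_right m n) (floorPoint_mem_grid ht n))).trans ?_
    refine mul_le_mul_of_nonneg_left ((mul_sqrt_log_le_sqrt (holderDist_nonneg _ _)).trans
      (Real.sqrt_le_sqrt ?_)) hz
    rw [holderDist_comm t (floorPoint m t)]
    exact holderDist_triangle hh _ _ _
  have hb0 : Tendsto (fun p : ℕ × ℕ => z * Real.sqrt (holderDist h t (floorPoint p.1 t) +
      holderDist h t (floorPoint p.2 t))) atTop (𝓝 0) := by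
    have h2 := ((hlim.comp tendsto_fst).add (hlim.comp tendsto_snd))
    rw [prod_atTop_atTop_eq, add_zero] at h2
    have h3 := ((Real.continuous_sqrt.tendsto 0).comp h2).const_mul z
    simpa using h3
  rw [cauchySeq_iff_tendsto_dist_atTop_0]
  refine squeeze_zero (fun _ => dist_nonneg) (fun p => ?_) hb0
  rw [dist_comm, Real.dist_eq]
  exact hcauchy p.1 p.2

/-- The modulus of continuity passes to the limit. -/
lemma abs_gridLimit_sub_le (hh : ∀ j, 0 < h j ∧ h j ≤ 1) (hz : 0 ≤ z)
    (hf : ∀ k, ∀ s ∈ grid d k, ∀ t ∈ grid d k, |f t - f s| ≤ z * (holderDist h s t *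
      Real.sqrt (Real.log (1 + (holderDist h s t)⁻¹))))
    {s t : EuclideanSpace ℝ (Fin d)} (hs : s ∈ unitCube d) (ht : t ∈ unitCube d) :
    |gridLimit f t - gridLimit f s| ≤ z * (holderDist h s t *
      Real.sqrt (Real.log (1 + (holderDist h s t)⁻¹))) := by
  rcases (holderDist_nonneg (h := h) s t).eq_or_lt with h0 | h0
  · have hst := eq_of_holderDist_eq_zero (fun j => (hh j).1) h0.symm
    rw [← h0, hst, sub_self, abs_zero, zero_mul, mul_zero]
  have h1 : Tendsto (fun n => |f (floorPoint n t) - f (floorPoint n s)|) atTop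
      (𝓝 |gridLimit f t - gridLimit f s|) :=
    ((tendsto_gridLimit hh hz hf ht).sub (tendsto_gridLimit hh hz hf hs)).abs
  have h2 : Tendsto (fun n => holderDist h (floorPoint n s) (floorPoint n t)) atTop
      (𝓝 (holderDist h s t)) := by
    have h4 := ((continuous_holderDist fun j => (hh j).1).tendsto (s, t)).comp
      ((tendsto_floorPoint hs).prodMk_nhds (tendsto_floorPoint ht))
    simpa only [Function.comp_def] using h4
  generalize holderDist h s t = x at h0 h2 ⊢
  have h3 : ContinuousAt (fun x : ℝ => z * (x * Real.sqrt (Real.log (1 + x⁻¹)))) x := by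
    have hx : 1 + x⁻¹ ≠ 0 := by positivity
    exact continuousAt_const.mul (continuousAt_id.mul (((continuousAt_const.add
      (continuousAt_id.inv₀ h0.ne')).log hx).sqrt))
  exact le_of_tendsto_of_tendsto' h1 (h3.tendsto.comp h2) fun n =>
    hf n _ (floorPoint_mem_grid hs n) _ (floorPoint_mem_grid ht n)

/-- The values at the grid points converge to V(t) in L² by the variance bound and to the grid limit
almost surely. Fatou's lemma forces the two limits to agree. -/
lemma gridLimit_ae_eq {V : EuclideanSpace ℝ (Fin d) → Ω → ℝ} (hh : ∀ j, 0 < h j ∧ h j ≤ 1)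
    (hVm : ∀ t, Measurable (V t)) (hV2 : ∀ t, MemLp (V t) 2 P) {C : ℝ}
    (hVC : ∀ s ∈ unitCube d, ∀ t ∈ unitCube d,
      ∫ ω, (V t ω - V s ω) ^ 2 ∂P ≤ C * holderDist h s t ^ 2)
    {t : EuclideanSpace ℝ (Fin d)} (ht : t ∈ unitCube d)
    (hlim : ∀ᵐ ω ∂P, Tendsto (fun n => V (floorPoint n t) ω) atTop
      (𝓝 (gridLimit (fun u => V u ω) t))) :
    (fun ω => gridLimit (fun u => V u ω) t) =ᵐ[P] V t := by
  have hgrid : ∀ n, floorPoint n t ∈ unitCube d := fun n =>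
    grid_subset_unitCube n (floorPoint_mem_grid ht n)
  have hdist : Tendsto (fun n => C * holderDist h (floorPoint n t) t ^ 2) atTop (𝓝 0) := by
    have h1 := ((continuous_holderDist fun j => (hh j).1).tendsto (t, t)).comp
      ((tendsto_floorPoint ht).prodMk_nhds tendsto_const_nhds)
    rw [holderDist_self fun j => (hh j).1] at h1
    simpa using (h1.pow 2).const_mul C
  have hL2 : Tendsto (fun n => ∫⁻ ω, ENNReal.ofReal ((V t ω - V (floorPoint n t) ω) ^ 2) ∂P) atTop
      (𝓝 0) := by
    have h0 : Tendsto (fun n => ENNReal.ofReal (C * holderDist h (floorPoint n t) t ^ 2)) atTop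
        (𝓝 0) := by
      simpa [Function.comp_def] using (ENNReal.continuous_ofReal.tendsto 0).comp hdist
    refine tendsto_of_tendsto_of_tendsto_of_le_of_le tendsto_const_nhds h0 (fun _ => zero_le)
      fun n => ?_
    have hi : Integrable (fun ω => (V t ω - V (floorPoint n t) ω) ^ 2) P :=
      ((hV2 t).sub (hV2 _)).integrable_sq
    rw [← ofReal_integral_eq_lintegral_ofReal hi
      (ae_of_all _ fun ω => sq_nonneg _)]
    exact ENNReal.ofReal_le_ofReal (hVC _ (hgrid n) t ht)
  have hm : ∀ n, Measurable fun ω => ENNReal.ofReal ((V t ω - V (floorPoint n t) ω) ^ 2) :=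
    fun n => by
      have h1 := hVm t
      have h2 := hVm (floorPoint n t)
      fun_prop
  have hfatou : ∫⁻ ω, liminf (fun n => ENNReal.ofReal ((V t ω - V (floorPoint n t) ω) ^ 2)) atTop ∂P
      ≤ _ := lintegral_liminf_le hm
  have hml : Measurable fun ω =>
      liminf (fun n => ENNReal.ofReal ((V t ω - V (floorPoint n t) ω) ^ 2)) atTop :=
    Measurable.liminf hm
  rw [hL2.liminf_eq, nonpos_iff_eq_zero, lintegral_eq_zero_iff hml] at hfatou
  filter_upwards [hfatou, hlim] with ω h1 h2
  have h3 : Tendsto (fun n => ENNReal.ofReal ((V t ω - V (floorPoint n t) ω) ^ 2)) atTop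
      (𝓝 (ENNReal.ofReal ((V t ω - gridLimit (fun u => V u ω) t) ^ 2))) :=
    (ENNReal.continuous_ofReal.tendsto _).comp ((tendsto_const_nhds.sub h2).pow 2)
  rw [h3.liminf_eq, Pi.zero_apply, ENNReal.ofReal_eq_zero] at h1
  have h4 := pow_eq_zero_iff two_ne_zero |>.1 (le_antisymm h1 (sq_nonneg _))
  linarith

/-- The power `1 / 2 + ε` of the logarithm dominates the square root on bounded sets. -/
lemma sqrt_log_le {D ε : ℝ} (hD : 0 < D) (hε : 0 < ε) :
    ∃ K, 0 ≤ K ∧ ∀ x, 0 ≤ x → x ≤ D → x * Real.sqrt (Real.log (1 + x⁻¹)) ≤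
      K * (x * Real.log (1 + x⁻¹) ^ (1 / 2 + ε)) := by
  have hℓ : 0 < Real.log (1 + D⁻¹) := Real.log_pos (by
    have : 0 < D⁻¹ := by positivity
    linarith)
  -- For x ≤ D the logarithm is at least log(1 + 1/D), so this constant times its ε-th power is at
  -- least 1.
  refine ⟨Real.log (1 + D⁻¹) ^ (-ε), by positivity, fun x hx hxD => ?_⟩
  rcases hx.eq_or_lt with rfl | hx
  · simp
  have hlog : Real.log (1 + D⁻¹) ≤ Real.log (1 + x⁻¹) := by
    refine Real.log_le_log (by positivity) ?_
    have : D⁻¹ ≤ x⁻¹ := inv_anti₀ hx hxD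
    linarith
  have hpos := hℓ.trans_le hlog
  rw [mul_left_comm, Real.sqrt_eq_rpow, Real.rpow_add hpos, mul_left_comm _ (_ ^ (1 / 2 : ℝ)) _]
  refine mul_le_mul_of_nonneg_left (le_mul_of_one_le_right (by positivity) ?_) hx.le
  rw [Real.rpow_neg hℓ.le, inv_mul_eq_div, one_le_div (by positivity)]
  exact Real.rpow_le_rpow hℓ.le hlog hε.le

end Modification

end

/-! ### The variance bound and the conclusion -/

section

variable {d : ℕ} {α α' : Fin d → ℝ} {μ : Measure (Site d)} [IsProbabilityMeasure μ]
  {ν : Measure (EuclideanSpace ℝ (Fin d))} [IsProbabilityMeasure ν] {p : ℝ}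
  {Ω : Type*} [MeasurableSpace Ω] {P : Measure Ω} [IsProbabilityMeasure P]
  {W : EuclideanSpace ℝ (Fin d) → Ω → ℝ}

/-- The increments of the limit field are controlled by the anisotropic distance. -/
lemma IsLimitField.exists_holderDist_bound (hW : IsLimitField μ p ν α α' P W)
    (hα : ∀ k, α k ∈ Set.Ioo (0 : ℝ) 1) (hsum : 2 < ∑ k, 1 / α k) (hν_full : IsFull ν)
    (hμν : InDomainOfAttraction μ α ν) (hq : qGt α α' < 2) {H : Fin d → ℝ}
    (hH : IsAdmissible α α' H) :
    ∃ C, 0 ≤ C ∧ ∀ s ∈ unitCube d, ∀ t ∈ unitCube d,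
      ∫ ω, (W t ω - W s ω) ^ 2 ∂P ≤ C * holderDist (anisoExp α α' H) s t ^ 2 := by
  have hα0 : ∀ k, 0 < α k := fun k => (hα k).1
  have hlog := isLogCharFun_logCharFun
    (exists_isLogCharFun (charFun_ne_zero_of_domain hα0 hμν))
  obtain ⟨c, hc0, hc⟩ := hlog.exists_lower_bound hα0 hν_full hμν
  have hK := fun j (hj : j ∈ Ieq α α') =>
    exists_spectral_bound hα hsum hq hlog.1 hc0 hc hH hj
  obtain ⟨j₀, hj₀⟩ := Ieq_nonempty (α' := α') hsum
  obtain ⟨K₁, hK₁0, hK₁⟩ := hK j₀ hj₀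
  -- At h = 1 the bound for any one direction of I_= is finiteness of the full spectral integral,
  -- which the directions outside I_= need.
  have hK₁' := hK₁ 1 ⟨zero_le_one, le_rfl⟩
  simp only [ite_self, Real.one_rpow, mul_one] at hK₁'
  obtain ⟨C, hC0, hC⟩ := exists_increment_bound_of_coordinates (P := P) (W := W)
    (h := anisoExp α α' H) (fun t => (hW.gaussian.hasGaussianLaw_eval t).memLp_two) (fun j => by
      rcases lt_trichotomy (gammaZero α α') (ratio α α' j) with hj | hj | hj
      · exact hW.increment_bound_Ilt H hK₁0 hK₁' hj
      · exact hW.increment_bound_Ieq hlog.1 hK₁' hj (hK j (by simp [Ieq, hj]))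
      · exact hW.increment_bound_Igt H hK₁0 hK₁' hj) Finset.univ
  exact ⟨C, hC0, fun s hs t ht => hC t ht s hs fun k hk => absurd (Finset.mem_univ k) hk⟩

end

end OperatorScaling

end

theorem mainTheorem9 {d : ℕ} (hd : 1 ≤ d)
    (α α' : Fin d → ℝ) (hα : ∀ k, α k ∈ Set.Ioo (0 : ℝ) 1)
    (hα_one : d = 1 → ∀ k, α k < 1 / 2) (hα' : ∀ k, 0 < α' k)
    (μ : Measure (Site d)) [IsProbabilityMeasure μ] (hμ : IsEdgeLaw μ)
    (ν : Measure (EuclideanSpace ℝ (Fin d))) [IsProbabilityMeasure ν]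
    (hν_nonneg : ∀ᵐ x ∂ν, ∀ k, 0 ≤ x k) (hν_full : IsFull ν)
    (hμν : InDomainOfAttraction μ α ν)
    (p : ℝ) (hp : p ∈ Set.Ioo (0 : ℝ) 1)
    (hq : qGt α α' < 2)
    {Ω : Type*} [MeasurableSpace Ω] (P : Measure Ω) [IsProbabilityMeasure P]
    (W : EuclideanSpace ℝ (Fin d) → Ω → ℝ) (hW : IsLimitField μ p ν α α' P W) :
    ∃ W' : unitCube d → Ω → ℝ,
      (∀ t, Measurable (W' t)) ∧ (∀ t, W' t =ᵐ[P] W t) ∧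
      ∀ H : Fin d → ℝ, IsAdmissible α α' H → ∀ ε : ℝ, 0 < ε →
        ∃ Z : Ω → ℝ, Measurable Z ∧ ∀ᵐ ω ∂P, ∀ s t : unitCube d,
          |W' t ω - W' s ω| ≤ Z ω * aniso α α' H s t *
            Real.log (1 + (aniso α α' H s t)⁻¹) ^ (1 / 2 + ε) := by
  have hsum := two_lt_sum_inv hd hα hα_one
  let V : EuclideanSpace ℝ (Fin d) → Ω → ℝ := fun t => (hW.gaussian.aemeasurable t).mk (W t)
  have hVm : ∀ t, Measurable (V t) := fun t => (hW.gaussian.aemeasurable t).measurable_mk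
  have hVW : ∀ t, V t =ᵐ[P] W t := fun t => (hW.gaussian.aemeasurable t).ae_eq_mk.symm
  have hVgauss : IsGaussianProcess V P := hW.gaussian.congr fun t => (hVW t).symm
  have hV2 : ∀ t, MemLp (V t) 2 P := fun t => (hVgauss.hasGaussianLaw_eval t).memLp_two
  have hVg : ∀ s t, HasGaussianLaw (fun ω => V t ω - V s ω) P := fun s t =>
    hVgauss.hasGaussianLaw_fun_sub
  have hV0 : ∀ s t, ∫ ω, (V t ω - V s ω) ∂P = 0 := fun s t => by
    rw [integral_sub ((hV2 t).integrable one_le_two) ((hV2 s).integrable one_le_two),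
      integral_congr_ae (hVW t), integral_congr_ae (hVW s), hW.mean_zero, hW.mean_zero, sub_zero]
  have hVC : ∀ H : Fin d → ℝ, IsAdmissible α α' H → ∃ C, 0 ≤ C ∧
      ∀ s ∈ unitCube d, ∀ t ∈ unitCube d,
        ∫ ω, (V t ω - V s ω) ^ 2 ∂P ≤ C * holderDist (anisoExp α α' H) s t ^ 2 := fun H hH => by
    obtain ⟨C, hC0, hC⟩ := hW.exists_holderDist_bound hα hsum hν_full hμν hq hH
    refine ⟨C, hC0, fun s hs t ht => (le_of_eq (integral_congr_ae ?_)).trans (hC s hs t ht)⟩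
    filter_upwards [hVW t, hVW s] with ω h1 h2
    rw [h1, h2]
  obtain ⟨H₀, hH₀⟩ := exists_isAdmissible (α := α) (α' := α')
  have hexp := fun H (hH : IsAdmissible α α' H) j => anisoExp_mem hα hq hH j
  obtain ⟨C₀, hC₀, hVC₀⟩ := hVC H₀ hH₀
  obtain ⟨Z₀, -, hZ₀, hmod₀⟩ := exists_dyadic_modulus hd (hexp H₀ hH₀) hVm hVg hV0 hC₀ hVC₀
  -- The field is built from V alone, so one modification serves all H and ε. The auxiliary H₀
  -- enters only in the proof that it is almost surely equal to W at each point.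
  refine ⟨fun t ω => gridLimit (fun u => V u ω) t, fun t => ?_, fun t => ?_, fun H hH ε hε => ?_⟩
  · exact (StronglyMeasurable.limUnder fun n =>
      (hVm (floorPoint n t)).stronglyMeasurable).measurable
  · refine EventuallyEq.trans ?_ (hVW t)
    refine gridLimit_ae_eq (hexp H₀ hH₀) hVm hV2 hVC₀ t.2 ?_
    filter_upwards [hmod₀] with ω hω
    exact tendsto_gridLimit (hexp H₀ hH₀) (hZ₀ ω) hω t.2
  · obtain ⟨C, hC0, hC⟩ := hVC H hH
    -- The chaining is repeated with the given H; only the random constant and the exceptional null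
    -- set change.
    obtain ⟨Z, hZm, hZ, hmod⟩ := exists_dyadic_modulus hd (hexp H hH) hVm hVg hV0 hC0 hC
    obtain ⟨K, hK0, hK⟩ := sqrt_log_le (D := d) (by exact_mod_cast hd) hε
    refine ⟨fun ω => Z ω * K, hZm.mul_const K, ?_⟩
    filter_upwards [hmod] with ω hω s t
    have haniso : aniso α α' H s t = holderDist (anisoExp α α' H) s t := aniso_eq_sum H s t
    rw [haniso]
    refine (abs_gridLimit_sub_le (hexp H hH) (hZ ω) hω s.2 t.2).trans ?_
    rw [mul_assoc, mul_assoc]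
    exact mul_le_mul_of_nonneg_left (hK _ (holderDist_nonneg _ _)
      (holderDist_le (fun j => (hexp H hH j).1) s.2 t.2)) (hZ ω)
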